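/- Let $f:\mathbb R^n\to\mathbb R^n$ be smooth and let $\xi_1,\dots,\xi_m$ (indices cyclic mod $m$) be hyperbolic equilibria of $\dot x=f(x)$ with trajectories $\kappa_j$ from $\xi_j$ to $\xi_{j+1}$ forming a heteroclinic cycle of type Y. That is, $\kappa_j\subset P_j$ for flow-invariant linear subspaces $P_j$ with $\dim P_j=\dim L_j+1$, $L_j=P_{j-1}\cap P_j$; some eigenvectors of $df(\xi_j)$, with real eigenvalues, form a basis of a complement of $L_j$; and $L_j$ together with any subset of these eigenvectors spans a flow-invariant subspace. These eigenvectors are: $n^c_j$ contracting ones, which together with $L_j$ span $P_{j-1}$ (eigenvalues $c_{j,d}$); one expanding one, which lies in $P_j$ (eigenvalue $e_j$); and $n^t_j$ remaining, transverse ones (eigenvalues $t_{j,s}$). Put $n_j=n^t_j+1$. The eigenbases are chosen so that, modulo $P_j$ and up to scaling, the expanding and transverse eigenvectors at $\xi_{j+1}$ are a permutation, with permutation matrix $A_j$, of the contracting and transverse eigenvectors at $\xi_j$; in particular $n_{j+1}=n^c_j+n^t_j$. The collection of maps associated with the cycle consists of $g_j:\mathbb R^{n_j}\to\mathbb R^{n_{j+1}}$,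 $$g_j(w,z)=A_jB_j\begin{pmatrix}\{v_{j,d}\,|w|^{-c_{j,d}/e_j}\}_{1\le d\le n^c_j}\\ \{z_s|w|^{-t_{j,s}/e_j}\}_{1\le s\le n^t_j}\end{pmatrix},$$ where the $v_{j,d}$ are non-zero constants and the $B_j$ are non-degenerate diagonal matrices. The basic transition matrices are $M_j=A_j\widehat M_j$, where $\widehat M_j$ has size $n_{j+1}\times n_j$: its first column is $(-c_{j,1}/e_j,\dots,-c_{j,n^c_j}/e_j,-t_{j,1}/e_j,\dots,-t_{j,n^t_j}/e_j)^T$, its other columns vanish in the first $n^c_j$ rows and form the identity matrix in the last $n^t_j$ rows. Let $M=M_m\cdots M_1$. A coordinate vector of $\mathbb R^{n_1}$ is called insignificant if the eigenvector that it represents, when carried along the cycle indefinitely by the permutations $A_j$, is transverse at every equilibrium; these vectors span an $M$-invariant subspace $V^{\rm ins}$. The significant eigenvalues of $M$ are the complex eigenvalues of the map that $M$ induces on $\mathbb R^{n_1}/V^{\rm ins}$. Let $\lambda_{\max}$ be a significant eigenvalue of largest absolute value. A point $y$ is a fixed point of the collection if $g_m\circ\dots\circ g_1(y)=y$. Let $y^l=g_{l-1}\circ\dots\circ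 g_1(y)$ be the corresponding point in $\mathbb R^{n_l}$. The fixed point $y$ is asymptotically stable if for every $\delta>0$ there is $\varepsilon>0$ such that, for every $l$, the successive images under $g_l,g_{l+1},\dots$ (cyclically) of any $x\in\mathbb R^{n_l}$ with $|x-y^l|<\varepsilon$ (including $x$ itself) stay at distance less than $\delta$ from the corresponding images of $y^l$, and these distances tend to $0$. It is completely unstable if for some $\delta>0$ the set of $x\in\mathbb R^{n_1}$ whose successive images under $g_1,g_2,\dots$ (including $x$ itself) stay at distance less than $\delta$ from those of $y$, with these distances tending to $0$, has Lebesgue measure zero. Theorem. Suppose that for all $j$ the contracting eigenvalues $c_{j,d}$ are negative, the expanding eigenvalue $e_j$ is positive, and all transverse eigenvalues $t_{j,s}$ are negative. Then $\lambda_{\max}$ is real, and (a) if $\lambda_{\max}>1$, then $\mathbf 0$ is an asymptotically stable fixed point of the collection $\{g_1,\dots,g_m\}$; (b) if $\lambda_{\max}<1$, then $\mathbf 0$ is a completely unstable fixed point of the collection. -/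

import Mathlib

open Filter Topology MeasureTheory

/-! ## Collections of maps along a cycle and stability of their fixed points

Indices run through `Fin m`, whose addition is cyclic, so `j + 1` is the successor of `j` in the
cycle, and the index called `1` on paper is `0` here. -/

section Collections

variable {m : ℕ} [NeZero m] {N : Fin m → ℕ}

/-- The superposition of the `i` consecutive maps `g l`, `g (l + 1)`, ... that starts with `g l`
(the identity for `i = 0`). -/
def superpose (g : ∀ j, EuclideanSpace ℝ (Fin (N j)) → EuclideanSpace ℝ (Fin (N (j + 1)))) :
    (i : ℕ) → (l : Fin m) →
      EuclideanSpace ℝ (Fin (N l)) → EuclideanSpace ℝ (Fin (N ((· + 1)^[i] l)))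
  | 0, _, x => x
  | i + 1, l, x => superpose g i (l + 1) (g l x)

/-- `y` is a fixed point of the collection: one full round of the maps, starting with the first
one, sends `y` to itself. -/
def IsFixedPointOfCollection
    (g : ∀ j, EuclideanSpace ℝ (Fin (N j)) → EuclideanSpace ℝ (Fin (N (j + 1))))
    (y : EuclideanSpace ℝ (Fin (N 0))) : Prop :=
  (⟨(· + 1)^[m] 0, superpose g m 0 y⟩ : Σ j, EuclideanSpace ℝ (Fin (N j))) = ⟨0, y⟩

/-- The orbit of `x`, a point of the `l`-th space, stays `δ`-close to the orbit of `y`: apply the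
first `r < m` maps after the `l`-th section and then `k` full rounds. -/
def OrbitStaysClose
    (g : ∀ j, EuclideanSpace ℝ (Fin (N j)) → EuclideanSpace ℝ (Fin (N (j + 1))))
    (l : Fin m) (x y : EuclideanSpace ℝ (Fin (N l))) (δ : ℝ) : Prop :=
  ∀ r < m, ∀ k : ℕ, dist (superpose g (r + k * m) l x) (superpose g (r + k * m) l y) < δ

/-- On every section the orbit of `x` converges to the orbit of `y`. -/
def OrbitConverges
    (g : ∀ j, EuclideanSpace ℝ (Fin (N j)) → EuclideanSpace ℝ (Fin (N (j + 1))))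
    (l : Fin m) (x y : EuclideanSpace ℝ (Fin (N l))) : Prop :=
  ∀ r < m, Tendsto
    (fun k : ℕ => dist (superpose g (r + k * m) l x) (superpose g (r + k * m) l y)) atTop (𝓝 0)

/-- `y` is an asymptotically stable fixed point of the collection of maps `g`. -/
def IsAsymptoticallyStable
    (g : ∀ j, EuclideanSpace ℝ (Fin (N j)) → EuclideanSpace ℝ (Fin (N (j + 1))))
    (y : EuclideanSpace ℝ (Fin (N 0))) : Prop :=
  IsFixedPointOfCollection g y ∧
    ∀ δ > 0, ∃ ε > 0, ∀ l < m, ∀ x : EuclideanSpace ℝ (Fin (N ((· + 1)^[l] 0))),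
      dist x (superpose g l 0 y) < ε →
        OrbitStaysClose g ((· + 1)^[l] 0) x (superpose g l 0 y) δ ∧
        OrbitConverges g ((· + 1)^[l] 0) x (superpose g l 0 y)

/-- The `δ`-local basin of attraction of the fixed point `y`. -/
def localBasin
    (g : ∀ j, EuclideanSpace ℝ (Fin (N j)) → EuclideanSpace ℝ (Fin (N (j + 1))))
    (y : EuclideanSpace ℝ (Fin (N 0))) (δ : ℝ) : Set (EuclideanSpace ℝ (Fin (N 0))) :=
  {x | OrbitStaysClose g 0 x y δ ∧ OrbitConverges g 0 x y}

/-- `y` is a completely unstable fixed point of the collection of maps `g`. -/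
def IsCompletelyUnstable
    (g : ∀ j, EuclideanSpace ℝ (Fin (N j)) → EuclideanSpace ℝ (Fin (N (j + 1))))
    (y : EuclideanSpace ℝ (Fin (N 0))) : Prop :=
  IsFixedPointOfCollection g y ∧ ∃ δ > 0, volume (localBasin g y δ) = 0

/-- The product of `i` consecutive matrices `... * M (l + 1) * M l`. -/
def matrixSuperpose (M : ∀ j, Matrix (Fin (N (j + 1))) (Fin (N j)) ℝ) :
    (i : ℕ) → (l : Fin m) → Matrix (Fin (N ((· + 1)^[i] l))) (Fin (N l)) ℝ
  | 0, l => (1 : Matrix (Fin (N l)) (Fin (N l)) ℝ)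
  | i + 1, l => matrixSuperpose M i (l + 1) * M l

end Collections

theorem iterate_succ_cycle (m : ℕ) [NeZero m] (l : Fin m) : (· + 1)^[m] l = l := by
  have h : ∀ i : ℕ, (· + 1)^[i] l = l + Fin.ofNat m i := by
    intro i
    induction i with
    | zero => ext; simp [Fin.ofNat]
    | succ i ih =>
      rw [Function.iterate_succ_apply', ih]
      ext
      simp [Fin.val_add, Fin.ofNat, add_assoc]
  rw [h]
  ext
  simp [Fin.ofNat]

/-! ## Heteroclinic cycles of type Y -/

/-- A heteroclinic cycle of the smooth system `x' = f x`: hyperbolic equilibria `ξ j` and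
trajectories `κ j` from `ξ j` to `ξ (j + 1)`. -/
structure HeteroclinicCycle {n : ℕ} (f : EuclideanSpace ℝ (Fin n) → EuclideanSpace ℝ (Fin n))
    (m : ℕ) [NeZero m] where
  smooth : ContDiff ℝ (⊤ : ℕ∞) f
  ξ : Fin m → EuclideanSpace ℝ (Fin n)
  κ : Fin m → ℝ → EuclideanSpace ℝ (Fin n)
  equilibrium : ∀ j, f (ξ j) = 0
  hyperbolic : ∀ j, ∀ z : ℂ,
    ((fderiv ℝ f (ξ j)).toLinearMap.charpoly.map (algebraMap ℝ ℂ)).IsRoot z → z.re ≠ 0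
  trajectory : ∀ j τ, HasDerivAt (κ j) (f (κ j τ)) τ
  tendsto_atBot : ∀ j, Tendsto (κ j) atBot (𝓝 (ξ j))
  tendsto_atTop : ∀ j, Tendsto (κ j) atTop (𝓝 (ξ (j + 1)))

/-- A linear subspace is invariant under the system `x' = f x` (the vector field is tangent
to it). -/
def IsFlowInvariant {n : ℕ} (f : EuclideanSpace ℝ (Fin n) → EuclideanSpace ℝ (Fin n))
    (P : Submodule ℝ (EuclideanSpace ℝ (Fin n))) : Prop :=
  ∀ x ∈ P, f x ∈ P

/-- Labels of the non-radial eigendirections at an equilibrium with `p` contracting and `q`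
transverse directions: contracting, expanding, transverse. -/
inductive Direction (p q : ℕ) where
  | con (d : Fin p)
  | exp
  | tra (s : Fin q)

/-- A heteroclinic cycle of type Y, with the eigenbases at its equilibria. -/
structure TypeYCycle {n : ℕ} (f : EuclideanSpace ℝ (Fin n) → EuclideanSpace ℝ (Fin n))
    (m : ℕ) [NeZero m] extends HeteroclinicCycle f m where
  /-- the invariant subspaces that contain the connections -/
  P : Fin m → Submodule ℝ (EuclideanSpace ℝ (Fin n))
  P_invariant : ∀ j, IsFlowInvariant f (P j)
  κ_mem : ∀ j τ, κ j τ ∈ P j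
  finrank_P : ∀ j, Module.finrank ℝ (P j) =
    Module.finrank ℝ (P (j - 1) ⊓ P j : Submodule ℝ (EuclideanSpace ℝ (Fin n))) + 1
  /-- the numbers of contracting eigenvalues -/
  nc : Fin m → ℕ
  /-- the numbers of transverse eigenvalues -/
  nt : Fin m → ℕ
  /-- the eigenvectors of the linearisation at `ξ j` that do not belong to `P (j - 1) ⊓ P j` -/
  v : ∀ j, Direction (nc j) (nt j) → EuclideanSpace ℝ (Fin n)
  /-- the eigenvalues that belong to them -/
  ev : ∀ j, Direction (nc j) (nt j) → ℝ
  eigen : ∀ j i, fderiv ℝ f (ξ j) (v j i) = ev j i • v j i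
  v_independent : ∀ j, LinearIndependent ℝ (v j)
  v_complement : ∀ j, IsCompl (P (j - 1) ⊓ P j) (Submodule.span ℝ (Set.range (v j)))
  /-- radial and contracting eigenvectors span `P (j - 1)` -/
  span_con : ∀ j, (P (j - 1) ⊓ P j) ⊔ Submodule.span ℝ (Set.range fun d => v j (.con d)) =
    P (j - 1)
  /-- the expanding eigenvector belongs to `P j` (so with the radial ones it spans `P j`) -/
  exp_mem : ∀ j, v j .exp ∈ P j
  /-- any of the eigenvectors `v j` together with `P (j - 1) ⊓ P j` span an invariant subspace -/
  span_invariant : ∀ j, ∀ S : Set (Direction (nc j) (nt j)),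
    IsFlowInvariant f ((P (j - 1) ⊓ P j) ⊔ Submodule.span ℝ (v j '' S))

namespace TypeYCycle

variable {n m : ℕ} [NeZero m] {f : EuclideanSpace ℝ (Fin n) → EuclideanSpace ℝ (Fin n)}

/-- contracting eigenvalues -/
def c (X : TypeYCycle f m) (j : Fin m) (d : Fin (X.nc j)) : ℝ := X.ev j (.con d)

/-- the expanding eigenvalue -/
def e (X : TypeYCycle f m) (j : Fin m) : ℝ := X.ev j .exp

/-- transverse eigenvalues -/
def t (X : TypeYCycle f m) (j : Fin m) (s : Fin (X.nt j)) : ℝ := X.ev j (.tra s)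

/-- The basis of contracting and transverse eigenvectors at `ξ j`, of a complement of `P j`. -/
def basisOut (X : TypeYCycle f m) (j : Fin m) :
    Fin (X.nc j) ⊕ Fin (X.nt j) → EuclideanSpace ℝ (Fin n) :=
  Sum.elim (fun d => X.v j (.con d)) (fun s => X.v j (.tra s))

/-- The basis of expanding and transverse eigenvectors at `ξ j`, of a complement of
`P (j - 1)`; it is the basis for the coordinates `(w, z)`. -/
def basisIn (X : TypeYCycle f m) (j : Fin m) : Fin (X.nt j + 1) → EuclideanSpace ℝ (Fin n) :=
  Fin.cons (X.v j .exp) (fun s => X.v j (.tra s))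

/-- The ingredients of a collection of maps associated with a type Y cycle. The permutation
`perm j` (the matrix `A j`) is determined by the cycle. The constants, which depend on the position
of the sections near the equilibria, may be any non-zero numbers. -/
structure MapData (X : TypeYCycle f m) where
  /-- the permutation that matches the basis of contracting and transverse eigenvectors at `ξ j`
  with the basis of expanding and transverse eigenvectors at `ξ (j + 1)` -/
  perm : ∀ j, Fin (X.nc j) ⊕ Fin (X.nt j) ≃ Fin (X.nt (j + 1) + 1)
  /-- matched vectors span the same line modulo `P j` (their own lengths and their components
  in `P j` play no role) -/
  perm_spec : ∀ j i, X.basisIn (j + 1) (perm j i) ∈ X.P j ⊔ Submodule.span ℝ {X.basisOut j i}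
  /-- contracting coordinates of the point where the incoming connection enters the
  neighbourhood of `ξ j` -/
  v₀ : ∀ j, Fin (X.nc j) → ℝ
  v₀_ne_zero : ∀ j d, v₀ j d ≠ 0
  /-- diagonal entries of the linear part of the global map along `κ j` -/
  β : ∀ j, Fin (X.nc j) ⊕ Fin (X.nt j) → ℝ
  β_ne_zero : ∀ j i, β j i ≠ 0

namespace MapData

variable {X : TypeYCycle f m}

/-- Contracting and transverse coordinates in which the trajectory that enters the neighbourhood
of `ξ j` with coordinates `(w, z) = x` leaves it. Here `w = x 0` and `z s = x s.succ`. -/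
noncomputable def localMap (D : X.MapData) (j : Fin m)
    (x : EuclideanSpace ℝ (Fin (X.nt j + 1))) : Fin (X.nc j) ⊕ Fin (X.nt j) → ℝ
  | .inl d => D.v₀ j d * |x 0| ^ (-X.c j d / X.e j)
  | .inr s => x s.succ * |x 0| ^ (-X.t j s / X.e j)

/-- The maps `g j` of the collection: the local map, then the diagonal matrix with entries
`β j`, then the permutation. -/
noncomputable def g (D : X.MapData) (j : Fin m) (x : EuclideanSpace ℝ (Fin (X.nt j + 1))) :
    EuclideanSpace ℝ (Fin (X.nt (j + 1) + 1)) :=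
  WithLp.toLp 2 fun k => D.β j ((D.perm j).symm k) * D.localMap j x ((D.perm j).symm k)

/-- The unpermuted basic transition matrix: its first column holds `-c/e` and `-t/e`, and an
identity block stands in the rows of the transverse coordinates. -/
noncomputable def rawTransition (X : TypeYCycle f m) (j : Fin m) :
    Matrix (Fin (X.nc j) ⊕ Fin (X.nt j)) (Fin (X.nt j + 1)) ℝ
  | .inl d => Fin.cons (-X.c j d / X.e j) 0
  | .inr s => Fin.cons (-X.t j s / X.e j) (Pi.single s 1)

/-- The basic transition matrix: `rawTransition` with its rows permuted by `perm j`. -/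
noncomputable def basicTransition (D : X.MapData) (j : Fin m) :
    Matrix (Fin (X.nt (j + 1) + 1)) (Fin (X.nt j + 1)) ℝ :=
  (rawTransition X j).submatrix (D.perm j).symm id

/-- The transition matrix of the full round, the product of all basic transition matrices,
the first one rightmost. -/
noncomputable def transition (D : X.MapData) :
    Matrix (Fin (X.nt 0 + 1)) (Fin (X.nt 0 + 1)) ℝ :=
  (matrixSuperpose (N := fun j => X.nt j + 1) D.basicTransition m 0).submatrix
    (Fin.cast (by rw [iterate_succ_cycle])) id

/-- Carried along the cycle, the `k`-th vector of `basisIn j` is a transverse eigenvector at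
`ξ j` and at the next `i` equilibria. -/
def StaysTransverse (D : X.MapData) : (i : ℕ) → (j : Fin m) → Fin (X.nt j + 1) → Prop
  | 0, _, k => k ≠ 0
  | i + 1, j, k => ∃ s : Fin (X.nt j), k = s.succ ∧ D.StaysTransverse i (j + 1) (D.perm j (.inr s))

/-- The complexification of the subspace spanned by the insignificant coordinate vectors, those
that stay transverse forever. -/
noncomputable def insignificant (D : X.MapData) : Submodule ℂ (Fin (X.nt 0 + 1) → ℂ) :=
  Submodule.span ℂ
    ((fun k => Pi.single k (1 : ℂ)) '' {k : Fin (X.nt 0 + 1) | ∀ i, D.StaysTransverse i 0 k})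

/-- `z` is a significant eigenvalue of the transition matrix, that is, an eigenvalue of the map
that it induces on the quotient by the (invariant) insignificant subspace. -/
def IsSignificantEigenvalue (D : X.MapData) (z : ℂ) : Prop :=
  ∃ u : Fin (X.nt 0 + 1) → ℂ, u ∉ D.insignificant ∧
    (D.transition.map (algebraMap ℝ ℂ)).mulVec u - z • u ∈ D.insignificant

/-- `z` is a significant eigenvalue of the largest absolute value. -/
def IsLargestSignificantEigenvalue (D : X.MapData) (z : ℂ) : Prop :=
  D.IsSignificantEigenvalue z ∧ ∀ z', D.IsSignificantEigenvalue z' → ‖z'‖ ≤ ‖z‖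

end MapData

end TypeYCycle

/-! ## Nonnegative matrices -/

section Nonneg

variable {ι : Type*} [Fintype ι]

/-! In logarithmic coordinates each map `g j` is affine with linear part `basicTransition j`, so
near the origin the growth of the transition matrices decides stability. The sign conditions make
these matrices nonnegative with a positive first column. They are assembled into one square
block-cyclic matrix C (`cyclicTransition`) on the sum of all sections; C^m is block diagonal, and
its block at section 0 is the transition matrix.

Significant rows of C vanish in insignificant columns, and every coordinate is reached from every
significant one. The significant block is therefore irreducible, and Perron-Frobenius
(`Matrix.exists_pos_eigenvectors_on`) gives it an eigenvalue r with positive right and left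
eigenvectors u and p. Then r^m is a significant eigenvalue that bounds all others. Since C^m has a
positive diagonal entry at the expanding coordinate, r^m is the only one of its modulus
(`Matrix.block_eigenvalue_le`), so the largest significant eigenvalue is r^m.

If r > 1, u is extended to a positive U with CU ≥ qU and q > 1 (`Matrix.exists_pos_growing`). The
boxes |x_l| ≤ exp(-R U_l) are then mapped into boxes with R multiplied by some q' > 1, once R is
large enough to absorb the constants (`exists_contraction`).

If r < 1, the weighted sum L = Σ p_l log|x_l| evolves by L ↦ const + rL and stays bounded below,
whereas convergence to 0 would force L to -∞. Hence only points on coordinate hyperplanes, a null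
set, can be attracted. -/

theorem Matrix.mulVec_nonneg_of_nonneg {A : Matrix ι ι ℝ} (hA : ∀ i j, 0 ≤ A i j) {x : ι → ℝ}
    (hx : ∀ i, 0 ≤ x i) (i : ι) : 0 ≤ A.mulVec x i :=
  Finset.sum_nonneg fun j _ => mul_nonneg (hA i j) (hx j)

theorem Matrix.mulVec_pos_of_pos {A : Matrix ι ι ℝ} (hA : ∀ i j, 0 < A i j) {x : ι → ℝ}
    (hx : ∀ i, 0 ≤ x i) (hx0 : x ≠ 0) (i : ι) : 0 < A.mulVec x i := by
  obtain ⟨j, hj⟩ := Function.ne_iff.1 hx0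
  exact Finset.sum_pos' (fun j _ => mul_nonneg (hA i j).le (hx j))
    ⟨j, Finset.mem_univ j, mul_pos (hA i j) (lt_of_le_of_ne (hx j) (Ne.symm hj))⟩

theorem Matrix.pow_nonneg_of_nonneg [DecidableEq ι] {A : Matrix ι ι ℝ} (hA : ∀ i j, 0 ≤ A i j)
    (k : ℕ) : ∀ i j, 0 ≤ (A ^ k) i j := by
  induction k with
  | zero => intro i j; rw [pow_zero, Matrix.one_apply]; split_ifs <;> norm_num
  | succ k ih =>
    intro i j
    rw [pow_succ]
    exact Finset.sum_nonneg fun l _ => mul_nonneg (ih i l) (hA l j)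

theorem Matrix.vecMul_pow_eq [DecidableEq ι] {A : Matrix ι ι ℝ} {p : ι → ℝ} {r : ℝ}
    (h : A.vecMul p = r • p) (k : ℕ) : (A ^ k).vecMul p = r ^ k • p := by
  induction k with
  | zero => simp
  | succ k ih => rw [pow_succ, ← Matrix.vecMul_vecMul, ih, Matrix.smul_vecMul, h,
      smul_smul, pow_succ]

/-- Rows in `S` see only columns in `S`, so an eigenvector equation known only on `S` can be
iterated there. -/
theorem Matrix.pow_mulVec_on [DecidableEq ι] {A : Matrix ι ι ℝ} {S : ι → Prop}
    (htri : ∀ i j, S i → ¬ S j → A i j = 0) {x : ι → ℝ} {r : ℝ}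
    (h : ∀ i, S i → A.mulVec x i = r * x i) (k : ℕ) :
    ∀ i, S i → (A ^ k).mulVec x i = r ^ k * x i := by
  induction k with
  | zero => intro i _; simp
  | succ k ih =>
    intro i hi
    rw [pow_succ', ← Matrix.mulVec_mulVec, Matrix.mulVec, dotProduct]
    calc ∑ j, A i j * (A ^ k).mulVec x j = ∑ j, r ^ k * (A i j * x j) := by
          refine Finset.sum_congr rfl fun j _ => ?_
          by_cases hj : S j
          · rw [ih j hj]; ring
          · rw [htri i j hi hj]; ring
      _ = r ^ (k + 1) * x i := by
          rw [← Finset.mul_sum]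
          have := h i hi
          rw [Matrix.mulVec, dotProduct] at this
          rw [this]; ring

/-- An irreducible nonnegative matrix commutes with some positive matrix. -/
theorem Matrix.exists_pos_commute [DecidableEq ι] {A : Matrix ι ι ℝ} (hA : ∀ i j, 0 ≤ A i j)
    (hirr : ∀ i j, ∃ k, 0 < (A ^ k) i j) :
    ∃ B : Matrix ι ι ℝ, (∀ i j, 0 < B i j) ∧ A * B = B * A := by
  choose k hk using hirr
  -- One power for each pair of indices, chosen so that its entry at that pair is positive; the
  -- remaining powers contribute nonnegative entries.
  refine ⟨∑ p : ι × ι, A ^ k p.1 p.2, fun i j => ?_, ?_⟩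
  · rw [Matrix.sum_apply]
    exact Finset.sum_pos' (fun p _ => Matrix.pow_nonneg_of_nonneg hA _ i j)
      ⟨(i, j), Finset.mem_univ _, hk i j⟩
  · rw [Finset.mul_sum, Finset.sum_mul]
    exact Finset.sum_congr rfl fun p _ => (pow_mul_comm' A _).symm

/-- Perron-Frobenius: an irreducible nonnegative matrix has a positive eigenvector. -/
theorem Matrix.exists_pos_eigenvector [DecidableEq ι] [Nonempty ι] {A : Matrix ι ι ℝ}
    (hA : ∀ i j, 0 ≤ A i j) (hirr : ∀ i j, ∃ k, 0 < (A ^ k) i j) :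
    ∃ r : ℝ, 0 ≤ r ∧ ∃ u : ι → ℝ, (∀ i, 0 < u i) ∧ A.mulVec u = r • u := by
  obtain ⟨B, hB, hAB⟩ := Matrix.exists_pos_commute hA hirr
  set R : ℝ := ∑ i, ∑ j, A i j with hR
  -- Collatz-Wielandt: the largest r with r x ≤ A x for some x in the simplex will be the
  -- eigenvalue. The bound `R` only serves compactness.
  let K : Set (ℝ × (ι → ℝ)) :=
    (Set.Icc 0 R ×ˢ stdSimplex ℝ ι) ∩ {p | ∀ i, p.1 * p.2 i ≤ A.mulVec p.2 i}
  have hbound : ∀ (r : ℝ) (x : ι → ℝ), x ∈ stdSimplex ℝ ι → (∀ i, r * x i ≤ A.mulVec x i) →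
      r ≤ R := by
    intro r x hx h
    calc r = ∑ i, r * x i := by rw [← Finset.mul_sum, hx.2, mul_one]
      _ ≤ ∑ i, A.mulVec x i := Finset.sum_le_sum fun i _ => h i
      _ ≤ R := by
        refine Finset.sum_le_sum fun i _ => Finset.sum_le_sum fun j _ => ?_
        have : x j ≤ 1 := by
          rw [← hx.2]
          exact Finset.single_le_sum (fun i _ => hx.1 i) (Finset.mem_univ j)
        simpa using mul_le_mul_of_nonneg_left this (hA i j)
  have hK : IsCompact K := by
    refine (isCompact_Icc.prod (isCompact_stdSimplex ℝ ι)).inter_right ?_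
    simp only [Set.ofPred_forall]
    refine isClosed_iInter fun i => isClosed_le (by fun_prop) ?_
    simp only [Matrix.mulVec, dotProduct]
    fun_prop
  have hmem : ∀ (r : ℝ) (x : ι → ℝ), 0 ≤ r → (∀ i, 0 ≤ x i) → x ≠ 0 →
      (∀ i, r * x i ≤ A.mulVec x i) → ∃ y, (r, y) ∈ K := by
    intro r x hr hx hx0 h
    obtain ⟨j, hj⟩ := Function.ne_iff.1 hx0
    have hs : 0 < ∑ i, x i := Finset.sum_pos' (fun i _ => hx i)
      ⟨j, Finset.mem_univ j, lt_of_le_of_ne (hx j) (Ne.symm hj)⟩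
    have hy : (∑ i, x i)⁻¹ • x ∈ stdSimplex ℝ ι := by
      refine ⟨fun i => mul_nonneg (inv_nonneg.2 hs.le) (hx i), ?_⟩
      simp only [Pi.smul_apply, smul_eq_mul, ← Finset.mul_sum]
      exact inv_mul_cancel₀ hs.ne'
    have hy' : ∀ i, r * ((∑ i, x i)⁻¹ • x) i ≤ A.mulVec ((∑ i, x i)⁻¹ • x) i := by
      intro i
      rw [Matrix.mulVec_smul, Pi.smul_apply, Pi.smul_apply, smul_eq_mul, smul_eq_mul,
        mul_left_comm]
      exact mul_le_mul_of_nonneg_left (h i) (inv_nonneg.2 hs.le)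
    exact ⟨_, ⟨⟨hr, hbound r _ hy hy'⟩, hy⟩, hy'⟩
  have hne : K.Nonempty := by
    obtain ⟨y, hy⟩ := hmem 0 (fun _ => 1) le_rfl (fun _ => zero_le_one)
      (Function.ne_iff.2 ⟨Classical.arbitrary ι, one_ne_zero⟩)
      (fun i => by
        rw [zero_mul]
        exact Matrix.mulVec_nonneg_of_nonneg hA (fun _ => zero_le_one) i)
    exact ⟨_, hy⟩
  obtain ⟨⟨r, x⟩, ⟨⟨⟨hr, -⟩, hx⟩, hle⟩, hmax⟩ :=
    hK.exists_isMaxOn hne continuous_fst.continuousOn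
  simp only at hr hx hle
  have hx0 : x ≠ 0 := by
    rintro rfl
    simpa using hx.2
  set y := B.mulVec x with hy
  have hypos : ∀ i, 0 < y i := Matrix.mulVec_pos_of_pos hB hx.1 hx0
  -- Since `B` commutes with `A`, it carries the defect of `x` to that of `y`; a nonzero defect
  -- becomes strictly positive and leaves room to increase r.
  have hAy : A.mulVec y - r • y = B.mulVec (A.mulVec x - r • x) := by
    rw [hy, Matrix.mulVec_sub, Matrix.mulVec_mulVec, hAB, Matrix.mulVec_smul,
      Matrix.mulVec_mulVec]
  by_cases hz : A.mulVec x - r • x = 0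
  · exact ⟨r, hr, y, hypos, by rw [← sub_eq_zero, hAy, hz, Matrix.mulVec_zero]⟩
  exfalso
  have hstrict : ∀ i, 0 < (A.mulVec y - r • y) i := by
    rw [hAy]
    exact Matrix.mulVec_pos_of_pos hB (fun i => sub_nonneg.2 (hle i)) hz
  obtain ⟨i₀, hi₀⟩ := Finite.exists_min fun i => (A.mulVec y - r • y) i / y i
  -- The smallest relative surplus, so that (r + ε) y ≤ A y in every coordinate.
  set ε := (A.mulVec y - r • y) i₀ / y i₀ with hε
  have hεpos : 0 < ε := div_pos (hstrict i₀) (hypos i₀)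
  obtain ⟨y', hy'⟩ := hmem (r + ε) y (by positivity) (fun i => (hypos i).le)
    (Function.ne_iff.2 ⟨i₀, (hypos i₀).ne'⟩) (fun i => by
      have h1 := (le_div_iff₀ (hypos i)).1 (hi₀ i)
      rw [Pi.sub_apply, Pi.smul_apply, smul_eq_mul] at h1
      linarith)
  have h2 : r + ε ≤ r := hmax hy'
  linarith

/-- An irreducible nonnegative matrix has positive right and left eigenvectors with the same
eigenvalue. -/
theorem Matrix.exists_pos_eigenvectors [DecidableEq ι] [Nonempty ι] {A : Matrix ι ι ℝ}
    (hA : ∀ i j, 0 ≤ A i j) (hirr : ∀ i j, ∃ k, 0 < (A ^ k) i j) :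
    ∃ r : ℝ, 0 ≤ r ∧ ∃ u p : ι → ℝ, (∀ i, 0 < u i) ∧ (∀ i, 0 < p i) ∧
      A.mulVec u = r • u ∧ A.vecMul p = r • p := by
  obtain ⟨r, hr, u, hu, hru⟩ := Matrix.exists_pos_eigenvector hA hirr
  obtain ⟨r', -, p, hp, hrp⟩ := Matrix.exists_pos_eigenvector (A := A.transpose)
    (fun i j => hA j i) (fun i j => by
      obtain ⟨k, hk⟩ := hirr j i
      exact ⟨k, by rwa [← Matrix.transpose_pow]⟩)
  rw [Matrix.mulVec_transpose] at hrp
  -- Evaluating p A u in two ways identifies the left and right eigenvalues.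
  have h := Matrix.dotProduct_mulVec p A u
  rw [hru, hrp, dotProduct_smul, smul_dotProduct, smul_eq_mul, smul_eq_mul] at h
  have hpos : 0 < p ⬝ᵥ u := Finset.sum_pos (fun i _ => mul_pos (hp i) (hu i)) Finset.univ_nonempty
  obtain rfl : r = r' := mul_right_cancel₀ hpos.ne' h
  exact ⟨r, hr, u, p, hu, hp, hru, hrp⟩

/-- A version for a nonnegative matrix that is block triangular with one irreducible diagonal
block, whose rows and columns are given by `S`. -/
theorem Matrix.exists_pos_eigenvectors_on [DecidableEq ι] {A : Matrix ι ι ℝ}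
    (hA : ∀ i j, 0 ≤ A i j) {S : ι → Prop} (hS : ∃ i, S i)
    (htri : ∀ i j, S i → ¬ S j → A i j = 0)
    (hirr : ∀ i j, S i → S j → ∃ k, 0 < (A ^ k) i j) :
    ∃ r : ℝ, 0 ≤ r ∧ ∃ u p : ι → ℝ, (∀ i, S i → 0 < u i) ∧ (∀ i, ¬ S i → u i = 0) ∧
      (∀ i, S i → 0 < p i) ∧ (∀ i, ¬ S i → p i = 0) ∧
      (∀ i, S i → A.mulVec u i = r * u i) ∧ A.vecMul p = r • p := by
  classical
  let A' : Matrix {i // S i} {i // S i} ℝ := A.submatrix (↑) (↑)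
  have hsum : ∀ F : ι → ℝ, (∀ i, ¬ S i → F i = 0) → ∑ i, F i = ∑ i : {i // S i}, F i := by
    intro F hF
    rw [← Fintype.sum_subtype_add_sum_subtype S F,
      Finset.sum_eq_zero (s := (Finset.univ : Finset {i // ¬ S i})) fun i _ => hF i i.2, add_zero]
  -- Powers of the block are blocks of the powers: by `htri`, a product of entries starting from a
  -- row in `S` vanishes once it leaves `S`.
  have hpow : ∀ (k : ℕ) (i j : {i // S i}), (A' ^ k) i j = (A ^ k) i j := by
    intro k
    induction k with
    | zero => intro i j; simp [Matrix.one_apply, Subtype.ext_iff]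
    | succ k ih =>
      intro i j
      rw [pow_succ', pow_succ', Matrix.mul_apply, Matrix.mul_apply, hsum]
      · exact Finset.sum_congr rfl fun l _ => by rw [ih]; rfl
      · intro l hl
        rw [htri i l i.2 hl, zero_mul]
  obtain ⟨i₀, hi₀⟩ := hS
  have : Nonempty {i // S i} := ⟨⟨i₀, hi₀⟩⟩
  obtain ⟨r, hr, u, p, hu, hp, hru, hrp⟩ := Matrix.exists_pos_eigenvectors (A := A')
    (fun i j => hA _ _) (fun i j => by
      obtain ⟨k, hk⟩ := hirr i j i.2 j.2
      exact ⟨k, by rwa [hpow]⟩)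
  refine ⟨r, hr, fun i => if h : S i then u ⟨i, h⟩ else 0, fun i => if h : S i then p ⟨i, h⟩ else 0,
    fun i h => by simpa [h] using hu _, fun i h => by simp [h], fun i h => by simpa [h] using hp _,
    fun i h => by simp [h], fun i h => ?_, funext fun j => ?_⟩
  · rw [Matrix.mulVec, dotProduct, hsum _ fun l hl => by simp [hl]]
    simp only [dif_pos h]
    refine Eq.trans (Finset.sum_congr rfl fun l _ => ?_) (congrFun hru ⟨i, h⟩)
    rw [dif_pos l.2]; rfl
  · rw [Matrix.vecMul, dotProduct, hsum _ fun l hl => by simp [hl], Pi.smul_apply, smul_eq_mul]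
    by_cases h : S j
    · rw [dif_pos h]
      refine Eq.trans (Finset.sum_congr rfl fun l _ => ?_) (congrFun hrp ⟨j, h⟩)
      rw [dif_pos l.2]; rfl
    · rw [dif_neg h, mul_zero]
      exact Finset.sum_eq_zero fun l _ => by rw [htri l j l.2 h, mul_zero]

/-- Let a nonnegative matrix have the left eigenvector `p` for `r`, positive on `S` and zero
elsewhere. An eigenvalue on the block given by `S` is bounded by `r`, and it equals `r` if it has
the same absolute value and some diagonal entry that all of `S` leads to is positive. -/
theorem Matrix.block_eigenvalue_le [DecidableEq ι] {A : Matrix ι ι ℝ}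
    (hA : ∀ i j, 0 ≤ A i j) {S : ι → Prop} {p : ι → ℝ} {r : ℝ}
    (hp : ∀ i, S i → 0 < p i) (hp0 : ∀ i, ¬ S i → p i = 0) (hrp : A.vecMul p = r • p)
    {u : ι → ℂ} {z : ℂ} {i₁ : ι} (hi₁ : S i₁) (hu : u i₁ ≠ 0)
    (hz : ∀ i, S i → ∑ j, (A i j : ℂ) * u j = z * u i) :
    ‖z‖ ≤ r ∧ ∀ o, S o → 0 < A o o → (∃ k, 0 < (A ^ k) o i₁) → ‖z‖ = r → z = r := by
  have hp' : ∀ i, 0 ≤ p i := fun i => by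
    by_cases h : S i
    · exact (hp i h).le
    · exact (hp0 i h).ge
  set w : ι → ℝ := fun i => ‖u i‖ with hw
  have hw0 : ∀ i, 0 ≤ w i := fun i => norm_nonneg _
  have hterm : ∀ i j, ‖(A i j : ℂ) * u j‖ = A i j * w j := fun i j => by
    rw [norm_mul, Complex.norm_real, Real.norm_of_nonneg (hA i j)]
  have hle : ∀ i, S i → ‖z‖ * w i ≤ A.mulVec w i := by
    intro i hi
    rw [hw, ← norm_mul, ← hz i hi]
    refine (norm_sum_le _ _).trans (le_of_eq ?_)
    exact Finset.sum_congr rfl fun j _ => hterm i j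
  have hple : ∀ i, p i * (‖z‖ * w i) ≤ p i * A.mulVec w i := by
    intro i
    by_cases h : S i
    · exact mul_le_mul_of_nonneg_left (hle i h) (hp' i)
    · rw [hp0 i h, zero_mul, zero_mul]
  have hpw : 0 < p ⬝ᵥ w := Finset.sum_pos' (fun i _ => mul_nonneg (hp' i) (hw0 i))
    ⟨i₁, Finset.mem_univ _, mul_pos (hp i₁ hi₁) (norm_pos_iff.2 hu)⟩
  have hright : p ⬝ᵥ A.mulVec w = r * (p ⬝ᵥ w) := by
    rw [Matrix.dotProduct_mulVec, hrp, smul_dotProduct, smul_eq_mul]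
  have hleft : ∑ i, p i * (‖z‖ * w i) = ‖z‖ * (p ⬝ᵥ w) := by
    rw [dotProduct, Finset.mul_sum]
    exact Finset.sum_congr rfl fun i _ => by ring
  refine ⟨?_, fun o ho hoo hreach heq => ?_⟩
  · refine le_of_mul_le_mul_right ?_ hpw
    rw [← hleft, ← hright]
    exact Finset.sum_le_sum fun i _ => hple i
  -- Pairing with `p` turns the inequalities into an equality of sums, so each of them is an
  -- equality where `p` is positive.
  have hAw : ∀ i, S i → A.mulVec w i = r * w i := by
    have h1 : ∑ i, p i * (‖z‖ * w i) = ∑ i, p i * A.mulVec w i := by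
      rw [hleft, heq, ← hright, dotProduct]
    intro i hi
    have h2 := (Finset.sum_eq_sum_iff_of_le fun i _ => hple i).1 h1 i (Finset.mem_univ i)
    rw [← mul_left_cancel₀ (hp i hi).ne' h2, heq]
  have htri : ∀ i j, S i → ¬ S j → A i j = 0 := by
    intro i j hi hj
    have h1 : ∑ i, p i * A i j = 0 := by
      have := congrFun hrp j
      rwa [Pi.smul_apply, hp0 j hj, smul_zero] at this
    have h2 := (Finset.sum_eq_zero_iff_of_nonneg
      fun i _ => mul_nonneg (hp' i) (hA i j)).1 h1 i (Finset.mem_univ i)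
    exact (mul_eq_zero.1 h2).resolve_left (hp i hi).ne'
  -- If `u o` vanished, (A^k w)_o = r^k w_o would be zero although it contains a positive term at
  -- `i₁`.
  have huo : u o ≠ 0 := by
    intro h0
    obtain ⟨k, hk⟩ := hreach
    have h1 : (A ^ k).mulVec w o = 0 := by
      rw [Matrix.pow_mulVec_on htri hAw k o ho, hw]; simp [h0]
    have h2 := (Finset.sum_eq_zero_iff_of_nonneg
      fun j _ => mul_nonneg (Matrix.pow_nonneg_of_nonneg hA k o j) (hw0 j)).1 h1 i₁
      (Finset.mem_univ _)
    exact (mul_pos hk (norm_pos_iff.2 hu)).ne' h2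
  set a : ℂ := (A o o : ℂ) * u o with ha
  set b : ℂ := ∑ j ∈ Finset.univ.erase o, (A o j : ℂ) * u j with hb
  have hab : a + b = z * u o := by
    rw [← hz o ho, ← Finset.add_sum_erase _ _ (Finset.mem_univ o)]
  have hnorm : ‖a + b‖ = ‖a‖ + ‖b‖ := by
    refine le_antisymm (norm_add_le _ _) ?_
    have h1 : ‖b‖ ≤ ∑ j ∈ Finset.univ.erase o, A o j * w j := by
      refine (norm_sum_le _ _).trans (le_of_eq ?_)
      exact Finset.sum_congr rfl fun j _ => hterm o j
    rw [ha, hterm, ← ha, hab, norm_mul, heq]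
    have h2 := hAw o ho
    rw [Matrix.mulVec, dotProduct, ← Finset.add_sum_erase _ _ (Finset.mem_univ o)] at h2
    change _ ≤ r * w o
    linarith
  -- Equality in the triangle inequality in row `o` puts the diagonal term A_oo u_o and the whole
  -- sum z u_o on one ray, so z is real and nonnegative.
  have hray : SameRay ℝ a (a + b) :=
    (SameRay.refl a).add_right (sameRay_iff_norm_add.2 hnorm)
  have ha0 : a ≠ 0 := mul_ne_zero (by exact_mod_cast hoo.ne') huo
  obtain ⟨c, hc, hca⟩ := hray.exists_nonneg_left ha0
  have hzc : z = ((c * A o o : ℝ) : ℂ) := by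
    refine mul_right_cancel₀ huo ?_
    rw [← hab, ← hca, ha, Complex.real_smul]
    push_cast
    ring
  rw [← heq, hzc, Complex.norm_real, Real.norm_of_nonneg (mul_nonneg hc hoo.le)]

/-- A nonnegative vector that grows on `S` can be changed into a positive one that grows
everywhere, if every row outside `S` has a positive entry in some column of `S`. -/
theorem Matrix.exists_pos_growing {A : Matrix ι ι ℝ} [Nonempty ι]
    (hA : ∀ i j, 0 ≤ A i j) {S : ι → Prop} {u : ι → ℝ} {r : ℝ} (hr : 1 < r)
    (hu : ∀ i, S i → 0 < u i) (hu0 : ∀ i, ¬ S i → u i = 0)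
    (hru : ∀ i, S i → A.mulVec u i = r * u i)
    (hrow : ∀ i, ¬ S i → ∃ j, S j ∧ 0 < A i j) :
    ∃ q : ℝ, 1 < q ∧ ∃ U : ι → ℝ, (∀ i, 0 < U i) ∧ ∀ i, q * U i ≤ A.mulVec U i := by
  classical
  have hu' : ∀ i, 0 ≤ u i := fun i => by
    by_cases h : S i
    · exact (hu i h).le
    · exact (hu0 i h).ge
  have hpos : ∀ i, 0 < A.mulVec u i := by
    intro i
    by_cases h : S i
    · rw [hru i h]
      exact mul_pos (by linarith) (hu i h)
    · obtain ⟨j, hj, hij⟩ := hrow i h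
      exact Finset.sum_pos' (fun j _ => mul_nonneg (hA i j) (hu' j))
        ⟨j, Finset.mem_univ j, mul_pos hij (hu j hj)⟩
  obtain ⟨i₀, hi₀⟩ := Finite.exists_min fun i => A.mulVec u i
  -- With the value c outside `S`, A U ≥ A u ≥ 2c everywhere, so the new coordinates grow by a
  -- factor of at least 2.
  set c := A.mulVec u i₀ / 2 with hc
  have hcpos : 0 < c := half_pos (hpos i₀)
  let U : ι → ℝ := fun i => if S i then u i else c
  have hmono : ∀ i, A.mulVec u i ≤ A.mulVec U i := by
    refine fun i => Finset.sum_le_sum fun j _ => mul_le_mul_of_nonneg_left ?_ (hA i j)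
    by_cases h : S j
    · simp [U, h]
    · simpa [U, h, hu0 j h] using hcpos.le
  refine ⟨min r 2, lt_min hr one_lt_two, U, fun i => ?_, fun i => ?_⟩
  · by_cases h : S i
    · simpa [U, h] using hu i h
    · simpa [U, h] using hcpos
  · refine le_trans ?_ (hmono i)
    by_cases h : S i
    · rw [hru i h]
      simpa [U, h] using mul_le_mul_of_nonneg_right (min_le_left r 2) (hu i h).le
    · have h1 := hi₀ i
      have h2 : min r 2 * c ≤ 2 * c := mul_le_mul_of_nonneg_right (min_le_right r 2) hcpos.le
      simp only [U, h, if_false]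
      linarith

end Nonneg

/-! ## Block-cyclic matrices -/

section CyclicMatrix

theorem sigma_mk_fin_cast {m : ℕ} {N : Fin m → ℕ} {a b : Fin m} (h : a = b)
    (h' : N b = N a) (k : Fin (N b)) :
    (⟨a, Fin.cast h' k⟩ : Σ j, Fin (N j)) = ⟨b, k⟩ := by
  subst h; rfl

variable {m : ℕ} [NeZero m]

theorem iterate_succ_eq_add_nsmul (i : ℕ) (l : Fin m) : (· + 1)^[i] l = l + i • (1 : Fin m) := by
  induction i with
  | zero => simp
  | succ i ih => rw [Function.iterate_succ_apply', ih, succ_nsmul, add_assoc]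

theorem exists_iterate_succ_eq (l l' : Fin m) : ∃ i : ℕ, (· + 1)^[i] l = l' := by
  refine ⟨(l' - l).val, ?_⟩
  rw [iterate_succ_eq_add_nsmul]
  have h : ∀ i : ℕ, i • (1 : Fin m) = Fin.ofNat m i := by
    intro i
    induction i with
    | zero => ext; simp [Fin.ofNat]
    | succ i ih => rw [succ_nsmul, ih]; ext; simp [Fin.val_add, Fin.ofNat]
  rw [h]
  have h' : Fin.ofNat m (l' - l).val = l' - l := Fin.ext (Nat.mod_eq_of_lt (l' - l).isLt)
  rw [h', add_sub_cancel]

variable {N : Fin m → ℕ}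

theorem exists_eq_mk_succ (t : Σ j, Fin (N j)) :
    ∃ (j : Fin m) (k : Fin (N (j + 1))), t = ⟨j + 1, k⟩ := by
  obtain ⟨j, k⟩ := t
  obtain ⟨j, rfl⟩ : ∃ i, j = i + 1 := ⟨j - 1, (sub_add_cancel j 1).symm⟩
  exact ⟨j, k, rfl⟩

variable (M : ∀ j, Matrix (Fin (N (j + 1))) (Fin (N j)) ℝ)

/-- The square matrix with the blocks `M j` that acts on the sum of all spaces of the cycle. -/
def cyclicMatrix : Matrix (Σ j, Fin (N j)) (Σ j, Fin (N j)) ℝ :=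
  -- Testing equality in the sigma type avoids a cast between `Fin (N t.1)` and `Fin (N (s.1 + 1))`.
  fun t s => ∑ k, if t = ⟨s.1 + 1, k⟩ then M s.1 k s.2 else 0

theorem cyclicMatrix_apply (j : Fin m) (k : Fin (N (j + 1))) (l : Fin (N j)) :
    cyclicMatrix M ⟨j + 1, k⟩ ⟨j, l⟩ = M j k l := by
  simp [cyclicMatrix]

theorem cyclicMatrix_of_ne {t s : Σ j, Fin (N j)} (h : t.1 ≠ s.1 + 1) :
    cyclicMatrix M t s = 0 :=
  Finset.sum_eq_zero fun _ _ => if_neg fun h' => h (congrArg Sigma.fst h')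

theorem cyclicMatrix_mulVec (F : (Σ j, Fin (N j)) → ℝ) (j : Fin m) (k : Fin (N (j + 1))) :
    (cyclicMatrix M).mulVec F ⟨j + 1, k⟩ = ∑ l, M j k l * F ⟨j, l⟩ := by
  rw [Matrix.mulVec, dotProduct, Fintype.sum_sigma, Finset.sum_eq_single j]
  · exact Finset.sum_congr rfl fun l _ => by rw [cyclicMatrix_apply]
  · intro i _ hij
    refine Finset.sum_eq_zero fun l _ => ?_
    rw [cyclicMatrix_of_ne M fun h => hij (add_right_cancel h).symm, zero_mul]
  · simp

theorem cyclicMatrix_vecMul (F : (Σ j, Fin (N j)) → ℝ) (j : Fin m) (l : Fin (N j)) :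
    (cyclicMatrix M).vecMul F ⟨j, l⟩ = ∑ k, F ⟨j + 1, k⟩ * M j k l := by
  rw [Matrix.vecMul, dotProduct, Fintype.sum_sigma, Finset.sum_eq_single (j + 1)]
  · exact Finset.sum_congr rfl fun k _ => by rw [cyclicMatrix_apply]
  · intro i _ hij
    refine Finset.sum_eq_zero fun k _ => ?_
    rw [cyclicMatrix_of_ne M hij, mul_zero]
  · simp

/-- Products of rectangular matrices along the cycle become powers of one square matrix, to which
spectral arguments apply. -/
theorem cyclicMatrix_pow_apply (i : ℕ) : ∀ (l : Fin m) (k : Fin (N ((· + 1)^[i] l)))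
    (k' : Fin (N l)),
    (cyclicMatrix M ^ i) ⟨(· + 1)^[i] l, k⟩ ⟨l, k'⟩ = matrixSuperpose M i l k k' := by
  induction i with
  | zero =>
    intro l k k'
    by_cases h : k = k'
    · subst h
      simp only [pow_zero, matrixSuperpose]
      exact (Matrix.one_apply_eq _).trans (Matrix.one_apply_eq _).symm
    · simp only [pow_zero, matrixSuperpose]
      refine (Matrix.one_apply_ne ?_).trans (Matrix.one_apply_ne h).symm
      intro h'
      exact h (eq_of_heq (Sigma.mk.inj h').2)
  | succ i ih =>
    intro l k k'
    rw [pow_succ]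
    refine (cyclicMatrix_vecMul M
      (fun s => (cyclicMatrix M ^ i) ⟨(· + 1)^[i + 1] l, k⟩ s) l k').trans ?_
    exact Finset.sum_congr rfl fun s _ => congrArg (· * M l s k') (ih (l + 1) k s)

theorem cyclicMatrix_pow_of_ne (i : ℕ) : ∀ {t s : Σ j, Fin (N j)}, t.1 ≠ (· + 1)^[i] s.1 →
    (cyclicMatrix M ^ i) t s = 0 := by
  induction i with
  | zero =>
    intro t s h
    rw [pow_zero]
    exact Matrix.one_apply_ne fun h' => h (congrArg Sigma.fst h')
  | succ i ih =>
    rintro t ⟨l, k'⟩ h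
    rw [pow_succ]
    refine (cyclicMatrix_vecMul M (fun s => (cyclicMatrix M ^ i) t s) l k').trans ?_
    exact Finset.sum_eq_zero fun s _ => by rw [ih h, zero_mul]

theorem cyclicMatrix_pow_cycle_of_ne {t s : Σ j, Fin (N j)} (h : t.1 ≠ s.1) :
    (cyclicMatrix M ^ m) t s = 0 :=
  cyclicMatrix_pow_of_ne M _ (by rwa [iterate_succ_cycle])

end CyclicMatrix

/-! ### Sign pattern and reachability of the cyclic transition matrix -/

namespace TypeYCycle

variable {n m : ℕ} [NeZero m] {f : EuclideanSpace ℝ (Fin n) → EuclideanSpace ℝ (Fin n)}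

namespace MapData

variable {X : TypeYCycle f m} (D : X.MapData)

/-- The block-cyclic matrix composed of all basic transition matrices. -/
noncomputable def cyclicTransition :
    Matrix (Σ j, Fin (X.nt j + 1)) (Σ j, Fin (X.nt j + 1)) ℝ :=
  cyclicMatrix (N := fun j => X.nt j + 1) D.basicTransition

/-- The coordinate is significant: carried along the cycle, it becomes expanding. -/
def Significant (t : Σ j, Fin (X.nt j + 1)) : Prop := ∃ i, ¬ D.StaysTransverse i t.1 t.2

theorem cyclicTransition_apply (j : Fin m) (k : Fin (X.nt (j + 1) + 1)) (l : Fin (X.nt j + 1)) :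
    D.cyclicTransition ⟨j + 1, k⟩ ⟨j, l⟩ = D.basicTransition j k l :=
  cyclicMatrix_apply (N := fun j => X.nt j + 1) D.basicTransition j k l

theorem cyclicTransition_of_ne {t s : Σ j, Fin (X.nt j + 1)} (h : t.1 ≠ s.1 + 1) :
    D.cyclicTransition t s = 0 :=
  cyclicMatrix_of_ne (N := fun j => X.nt j + 1) D.basicTransition h

theorem cyclicTransition_pow_of_ne {t s : Σ j, Fin (X.nt j + 1)} (h : t.1 ≠ s.1) :
    (D.cyclicTransition ^ m) t s = 0 :=
  cyclicMatrix_pow_cycle_of_ne (N := fun j => X.nt j + 1) D.basicTransition h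

theorem transition_apply (k k' : Fin (X.nt 0 + 1)) :
    D.transition k k' = (D.cyclicTransition ^ m) ⟨0, k⟩ ⟨0, k'⟩ := by
  have h := cyclicMatrix_pow_apply (N := fun j => X.nt j + 1) D.basicTransition m 0
    (Fin.cast (by rw [iterate_succ_cycle]) k) k'
  rw [sigma_mk_fin_cast (N := fun j => X.nt j + 1) (iterate_succ_cycle m 0)] at h
  exact h.symm

theorem basicTransition_zero_pos (hc : ∀ j d, X.c j d < 0) (he : ∀ j, 0 < X.e j)
    (ht : ∀ j s, X.t j s < 0) (j : Fin m) (k : Fin (X.nt (j + 1) + 1)) :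
    0 < D.basicTransition j k 0 := by
  obtain ⟨i, rfl⟩ := (D.perm j).surjective k
  rw [basicTransition, Matrix.submatrix_apply, Equiv.symm_apply_apply]
  cases i with
  | inl d => exact div_pos (neg_pos.2 (hc j d)) (he j)
  | inr s => exact div_pos (neg_pos.2 (ht j s)) (he j)

theorem basicTransition_inl_succ (j : Fin m) (d : Fin (X.nc j)) (s : Fin (X.nt j)) :
    D.basicTransition j (D.perm j (.inl d)) s.succ = 0 := by
  rw [basicTransition, Matrix.submatrix_apply, Equiv.symm_apply_apply]
  rfl

theorem basicTransition_inr_succ (j : Fin m) (s' s : Fin (X.nt j)) :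
    D.basicTransition j (D.perm j (.inr s')) s.succ = if s = s' then 1 else 0 := by
  rw [basicTransition, Matrix.submatrix_apply, Equiv.symm_apply_apply]
  exact Pi.single_apply s' 1 s

theorem basicTransition_nonneg (hc : ∀ j d, X.c j d < 0) (he : ∀ j, 0 < X.e j)
    (ht : ∀ j s, X.t j s < 0) (j : Fin m) (k : Fin (X.nt (j + 1) + 1)) (l : Fin (X.nt j + 1)) :
    0 ≤ D.basicTransition j k l := by
  refine Fin.cases (D.basicTransition_zero_pos hc he ht j k).le (fun s => ?_) l
  obtain ⟨i, rfl⟩ := (D.perm j).surjective k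
  cases i with
  | inl d => rw [basicTransition_inl_succ]
  | inr s' => rw [basicTransition_inr_succ]; split_ifs <;> norm_num

theorem cyclicTransition_nonneg (hc : ∀ j d, X.c j d < 0) (he : ∀ j, 0 < X.e j)
    (ht : ∀ j s, X.t j s < 0) (t s : Σ j, Fin (X.nt j + 1)) : 0 ≤ D.cyclicTransition t s := by
  obtain ⟨j, l⟩ := s
  by_cases h : t.1 = j + 1
  · obtain ⟨j', k⟩ := t
    change j' = j + 1 at h
    subst h
    rw [cyclicTransition_apply]
    exact D.basicTransition_nonneg hc he ht j k l
  · rw [D.cyclicTransition_of_ne h]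

theorem significant_zero (j : Fin m) : D.Significant ⟨j, 0⟩ := ⟨0, fun h => h rfl⟩

theorem staysTransverse_succ_iff (i : ℕ) (j : Fin m) (s : Fin (X.nt j)) :
    D.StaysTransverse (i + 1) j s.succ ↔ D.StaysTransverse i (j + 1) (D.perm j (.inr s)) := by
  constructor
  · rintro ⟨s', h, h'⟩
    rwa [Fin.succ_injective _ h]
  · exact fun h => ⟨s, rfl, h⟩

theorem significant_succ_iff (j : Fin m) (s : Fin (X.nt j)) :
    D.Significant ⟨j, s.succ⟩ ↔ D.Significant ⟨j + 1, D.perm j (.inr s)⟩ := by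
  constructor
  · rintro ⟨i, hi⟩
    cases i with
    | zero => exact absurd (Fin.succ_ne_zero s) hi
    | succ i => exact ⟨i, fun h => hi ((D.staysTransverse_succ_iff i j s).2 h)⟩
  · rintro ⟨i, hi⟩
    exact ⟨i + 1, fun h => hi ((D.staysTransverse_succ_iff i j s).1 h)⟩

/-- A non-expanding column has a single nonzero entry, in the row to which the permutation carries
that coordinate, and this carrying preserves significance both ways. -/
theorem cyclicTransition_of_significant {t s : Σ j, Fin (X.nt j + 1)} (htsig : D.Significant t)
    (hs : ¬ D.Significant s) : D.cyclicTransition t s = 0 := by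
  obtain ⟨j, l⟩ := s
  by_cases h : t.1 = j + 1
  · obtain ⟨j', k⟩ := t
    change j' = j + 1 at h
    subst h
    rw [cyclicTransition_apply]
    obtain ⟨i, rfl⟩ := (D.perm j).surjective k
    obtain rfl | ⟨s, rfl⟩ := Fin.eq_zero_or_eq_succ l
    · exact absurd (D.significant_zero j) hs
    cases i with
    | inl d => exact D.basicTransition_inl_succ j d s
    | inr s' =>
      rw [basicTransition_inr_succ, if_neg]
      rintro rfl
      exact hs ((D.significant_succ_iff j s).2 htsig)
  · exact D.cyclicTransition_of_ne h

theorem cyclicTransition_pow_nonneg (hc : ∀ j d, X.c j d < 0) (he : ∀ j, 0 < X.e j)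
    (ht : ∀ j s, X.t j s < 0) (i : ℕ) (t s : Σ j, Fin (X.nt j + 1)) :
    0 ≤ (D.cyclicTransition ^ i) t s :=
  Matrix.pow_nonneg_of_nonneg (D.cyclicTransition_nonneg hc he ht) i t s

theorem cyclicTransition_pow_trans (hc : ∀ j d, X.c j d < 0) (he : ∀ j, 0 < X.e j)
    (ht : ∀ j s, X.t j s < 0) {i i' : ℕ} {t s r : Σ j, Fin (X.nt j + 1)}
    (h : 0 < (D.cyclicTransition ^ i) t s) (h' : 0 < (D.cyclicTransition ^ i') s r) :
    0 < (D.cyclicTransition ^ (i + i')) t r := by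
  rw [pow_add]
  exact Finset.sum_pos' (fun q _ => mul_nonneg (D.cyclicTransition_pow_nonneg hc he ht _ _ _)
    (D.cyclicTransition_pow_nonneg hc he ht _ _ _)) ⟨s, Finset.mem_univ s, mul_pos h h'⟩

theorem cyclicTransition_pow_zero_zero_pos (hc : ∀ j d, X.c j d < 0) (he : ∀ j, 0 < X.e j)
    (ht : ∀ j s, X.t j s < 0) (i : ℕ) (j : Fin m) :
    0 < (D.cyclicTransition ^ i) ⟨(· + 1)^[i] j, 0⟩ ⟨j, 0⟩ := by
  induction i with
  | zero =>
    rw [pow_zero]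
    exact one_pos.trans_eq (Matrix.one_apply_eq (α := ℝ) (⟨j, 0⟩ : Σ j, Fin (X.nt j + 1))).symm
  | succ i ih =>
    have h : 0 < (D.cyclicTransition ^ 1) ⟨(· + 1)^[i] j + 1, 0⟩ ⟨(· + 1)^[i] j, 0⟩ := by
      rw [pow_one, cyclicTransition_apply]
      exact D.basicTransition_zero_pos hc he ht _ _
    rw [Function.iterate_succ_apply', add_comm i 1]
    exact D.cyclicTransition_pow_trans hc he ht h ih

/-- The coordinate is followed through its transverse steps, each with matrix entry 1, until it
becomes expanding. -/
theorem exists_pow_pos_zero (hc : ∀ j d, X.c j d < 0) (he : ∀ j, 0 < X.e j)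
    (ht : ∀ j s, X.t j s < 0) (i : ℕ) : ∀ (j : Fin m) (k : Fin (X.nt j + 1)),
    ¬ D.StaysTransverse i j k →
      ∃ i' j', 0 < (D.cyclicTransition ^ i') ⟨j', 0⟩ ⟨j, k⟩ := by
  induction i with
  | zero =>
    intro j k h
    obtain rfl : k = 0 := not_not.1 h
    exact ⟨0, _, D.cyclicTransition_pow_zero_zero_pos hc he ht 0 j⟩
  | succ i ih =>
    intro j k h
    obtain rfl | ⟨s, rfl⟩ := Fin.eq_zero_or_eq_succ k
    · exact ⟨0, _, D.cyclicTransition_pow_zero_zero_pos hc he ht 0 j⟩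
    · rw [staysTransverse_succ_iff] at h
      obtain ⟨i', j', h'⟩ := ih _ _ h
      refine ⟨i' + 1, j', D.cyclicTransition_pow_trans hc he ht h' ?_⟩
      rw [pow_one, cyclicTransition_apply, basicTransition_inr_succ, if_pos rfl]
      exact one_pos

/-- Every coordinate is reached from every significant one. -/
theorem exists_cyclicTransition_pow_pos (hc : ∀ j d, X.c j d < 0) (he : ∀ j, 0 < X.e j)
    (ht : ∀ j s, X.t j s < 0) (t : Σ j, Fin (X.nt j + 1)) {s : Σ j, Fin (X.nt j + 1)}
    (hs : D.Significant s) : ∃ i, 0 < (D.cyclicTransition ^ i) t s := by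
  obtain ⟨i, hi⟩ := hs
  obtain ⟨i₁, j, h₁⟩ := D.exists_pow_pos_zero hc he ht i s.1 s.2 hi
  obtain ⟨j', k, rfl⟩ := exists_eq_mk_succ (N := fun j => X.nt j + 1) t
  obtain ⟨i₂, rfl⟩ := exists_iterate_succ_eq j j'
  have h₂ := D.cyclicTransition_pow_zero_zero_pos hc he ht i₂ j
  -- The path runs from `s` to an expanding coordinate, along expanding coordinates to the section
  -- before that of `t`, and by the positive first column into `t`.
  refine ⟨1 + (i₂ + i₁), D.cyclicTransition_pow_trans hc he ht ?_
    (D.cyclicTransition_pow_trans hc he ht h₂ h₁)⟩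
  rw [pow_one, cyclicTransition_apply]
  exact D.basicTransition_zero_pos hc he ht _ _

/-- The expanding coordinate is reached from every significant one of the same section after
a number of full rounds. -/
theorem exists_cyclicTransition_pow_round_pos (hc : ∀ j d, X.c j d < 0) (he : ∀ j, 0 < X.e j)
    (ht : ∀ j s, X.t j s < 0) {j : Fin m} {k : Fin (X.nt j + 1)} (hk : D.Significant ⟨j, k⟩) :
    ∃ i, 0 < ((D.cyclicTransition ^ m) ^ i) ⟨j, 0⟩ ⟨j, k⟩ := by
  obtain ⟨i, hi⟩ := D.exists_cyclicTransition_pow_pos hc he ht ⟨j, 0⟩ hk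
  have hij : (· + 1)^[i] j = j := by
    by_contra h
    exact hi.ne' (cyclicMatrix_pow_of_ne (N := fun j => X.nt j + 1) D.basicTransition i
      (Ne.symm h))
  have h₀ : 0 < (D.cyclicTransition ^ i) ⟨j, 0⟩ ⟨j, 0⟩ := by
    have := D.cyclicTransition_pow_zero_zero_pos hc he ht i j
    rwa [hij] at this
  have h : ∀ r : ℕ, 0 < (D.cyclicTransition ^ (i * (r + 1))) ⟨j, 0⟩ ⟨j, k⟩ := by
    intro r
    induction r with
    | zero => rwa [zero_add, mul_one]
    | succ r ih =>
      rw [mul_add, mul_one, add_comm]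
      exact D.cyclicTransition_pow_trans hc he ht h₀ ih
  refine ⟨i, ?_⟩
  -- Adding the closed walk of length i at the expanding coordinate m - 1 times gives total length i
  -- m, a whole number of rounds.
  have h' := h (m - 1)
  rwa [Nat.sub_add_cancel (Nat.pos_of_neZero m), mul_comm, pow_mul] at h'

end MapData

end TypeYCycle

/-! ### Significant eigenvalues and Perron eigenvectors -/

namespace TypeYCycle

variable {n m : ℕ} [NeZero m] {f : EuclideanSpace ℝ (Fin n) → EuclideanSpace ℝ (Fin n)}

namespace MapData

variable {X : TypeYCycle f m} (D : X.MapData)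

theorem mem_insignificant_iff {u : Fin (X.nt 0 + 1) → ℂ} :
    u ∈ D.insignificant ↔ ∀ k, D.Significant ⟨0, k⟩ → u k = 0 := by
  constructor
  · intro hu k hk
    refine Submodule.span_induction (p := fun x _ => x k = 0) ?_ rfl
      (fun x y _ _ hx hy => by rw [Pi.add_apply, hx, hy, add_zero])
      (fun a x _ hx => by rw [Pi.smul_apply, hx, smul_zero]) hu
    rintro _ ⟨l, hl, rfl⟩
    obtain ⟨i, hi⟩ := hk
    refine Pi.single_eq_of_ne ?_ _
    rintro rfl
    exact hi (hl i)
  · intro h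
    rw [pi_eq_sum_univ' u]
    refine Submodule.sum_mem _ fun k _ => ?_
    by_cases hk : D.Significant ⟨0, k⟩
    · rw [h k hk, zero_smul]
      exact Submodule.zero_mem _
    · refine Submodule.smul_mem _ _ (Submodule.subset_span ⟨k, ?_, ?_⟩)
      · exact fun i => not_not.1 fun hi => hk ⟨i, hi⟩
      · ext l
        simp [Pi.single_apply, eq_comm]

theorem sum_transition_mul {R : Type*} [CommRing R] (φ : ℝ →+* R)
    (u : (Σ j, Fin (X.nt j + 1)) → R) (k : Fin (X.nt 0 + 1)) :
    ∑ l, φ (D.transition k l) * u ⟨0, l⟩ =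
      ∑ s, φ ((D.cyclicTransition ^ m) ⟨0, k⟩ s) * u s := by
  rw [Fintype.sum_sigma]
  symm
  rw [Finset.sum_eq_single 0]
  · exact Finset.sum_congr rfl fun l _ => by rw [transition_apply]
  · intro j _ hj
    refine Finset.sum_eq_zero fun l _ => ?_
    rw [D.cyclicTransition_pow_of_ne (Ne.symm hj), map_zero, zero_mul]
  · simp

theorem isSignificantEigenvalue_of_eigenvector {u : (Σ j, Fin (X.nt j + 1)) → ℝ} {r : ℝ}
    (hu : ∀ i, D.Significant i → 0 < u i)
    (hru : ∀ i, D.Significant i → D.cyclicTransition.mulVec u i = r * u i) :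
    D.IsSignificantEigenvalue ((r ^ m : ℝ) : ℂ) := by
  refine ⟨fun k => (u ⟨0, k⟩ : ℂ), ?_, ?_⟩
  · rw [mem_insignificant_iff]
    intro h
    have h0 := h 0 (D.significant_zero 0)
    exact (hu _ (D.significant_zero 0)).ne' (by exact_mod_cast h0)
  · rw [mem_insignificant_iff]
    intro k hk
    have h := Matrix.pow_mulVec_on (fun i j => D.cyclicTransition_of_significant) hru m _ hk
    have h' := D.sum_transition_mul Complex.ofRealHom (fun s => (u s : ℂ)) k
    rw [Pi.sub_apply, sub_eq_zero]
    refine h'.trans ?_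
    rw [Matrix.mulVec, dotProduct] at h
    simp only [Complex.ofRealHom_eq_coe, Pi.smul_apply, smul_eq_mul]
    exact_mod_cast h

theorem eigenvalue_le_of_left_eigenvector (hc : ∀ j d, X.c j d < 0) (he : ∀ j, 0 < X.e j)
    (ht : ∀ j s, X.t j s < 0) {p : (Σ j, Fin (X.nt j + 1)) → ℝ} {r : ℝ}
    (hp : ∀ i, D.Significant i → 0 < p i) (hp0 : ∀ i, ¬ D.Significant i → p i = 0)
    (hrp : D.cyclicTransition.vecMul p = r • p) {z : ℂ} (hz : D.IsSignificantEigenvalue z) :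
    ‖z‖ ≤ r ^ m ∧ (‖z‖ = r ^ m → z = (r ^ m : ℝ)) := by
  obtain ⟨u, hu, hzu⟩ := hz
  rw [mem_insignificant_iff] at hu hzu
  push Not at hu
  obtain ⟨k₁, hk₁, hne⟩ := hu
  -- The eigenvector of the round is extended by zero to the other sections. The m-th power need not
  -- be irreducible on all significant coordinates; `p` and reachability inside section 0 suffice.
  let U : (Σ j, Fin (X.nt j + 1)) → ℂ := fun t => ∑ k, if t = ⟨0, k⟩ then u k else 0
  have hU : ∀ k, U ⟨0, k⟩ = u k := fun k => by simp [U]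
  have hU0 : ∀ t : Σ j, Fin (X.nt j + 1), t.1 ≠ 0 → U t = 0 := fun t h =>
    Finset.sum_eq_zero fun k _ => if_neg fun h' => h (congrArg Sigma.fst h')
  have hzU : ∀ t, D.Significant t →
      ∑ s, (((D.cyclicTransition ^ m) t s : ℝ) : ℂ) * U s = z * U t := by
    rintro ⟨j, k⟩ hk
    by_cases hj : j = 0
    · subst hj
      refine (D.sum_transition_mul Complex.ofRealHom U k).symm.trans ?_
      have h := hzu k hk
      rw [Pi.sub_apply, sub_eq_zero] at h
      rw [hU]
      refine Eq.trans (Finset.sum_congr rfl fun l _ => ?_) h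
      rw [hU]
      rfl
    · rw [hU0 _ hj, mul_zero]
      refine Finset.sum_eq_zero fun s _ => ?_
      by_cases hs : s.1 = 0
      · rw [D.cyclicTransition_pow_of_ne (by rw [hs]; exact hj), Complex.ofReal_zero, zero_mul]
      · rw [hU0 s hs, mul_zero]
  obtain ⟨h1, h2⟩ := Matrix.block_eigenvalue_le (D.cyclicTransition_pow_nonneg hc he ht m) hp hp0
    (Matrix.vecMul_pow_eq hrp m) hk₁ (by rwa [hU]) hzU
  refine ⟨h1, h2 ⟨0, 0⟩ (D.significant_zero 0) ?_
    (D.exists_cyclicTransition_pow_round_pos hc he ht hk₁)⟩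
  have := D.cyclicTransition_pow_zero_zero_pos hc he ht m 0
  rwa [iterate_succ_cycle] at this

/-- The significant block of the cyclic transition matrix has positive eigenvectors, and the
largest significant eigenvalue is the `m`-th power of their eigenvalue. -/
theorem exists_perron_eigenvectors (hc : ∀ j d, X.c j d < 0) (he : ∀ j, 0 < X.e j)
    (ht : ∀ j s, X.t j s < 0) {lam : ℂ} (hlam : D.IsLargestSignificantEigenvalue lam) :
    ∃ r : ℝ, 0 ≤ r ∧ lam = (r ^ m : ℝ) ∧ ∃ u p : (Σ j, Fin (X.nt j + 1)) → ℝ,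
      (∀ i, D.Significant i → 0 < u i) ∧ (∀ i, ¬ D.Significant i → u i = 0) ∧
      (∀ i, D.Significant i → 0 < p i) ∧ (∀ i, ¬ D.Significant i → p i = 0) ∧
      (∀ i, D.Significant i → D.cyclicTransition.mulVec u i = r * u i) ∧
      D.cyclicTransition.vecMul p = r • p := by
  obtain ⟨r, hr, u, p, hu, hu0, hp, hp0, hru, hrp⟩ := Matrix.exists_pos_eigenvectors_on
    (D.cyclicTransition_nonneg hc he ht) (S := D.Significant) ⟨_, D.significant_zero 0⟩
    (fun i j => D.cyclicTransition_of_significant)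
    (fun i j _ hj => D.exists_cyclicTransition_pow_pos hc he ht i hj)
  refine ⟨r, hr, ?_, u, p, hu, hu0, hp, hp0, hru, hrp⟩
  obtain ⟨h1, h2⟩ := D.eigenvalue_le_of_left_eigenvector hc he ht hp hp0 hrp hlam.1
  refine h2 (le_antisymm h1 ?_)
  -- r^m is itself a significant eigenvalue, so the largest one has at least this modulus.
  have h3 := hlam.2 _ (D.isSignificantEigenvalue_of_eigenvector hu hru)
  rwa [Complex.norm_real, Real.norm_of_nonneg (pow_nonneg hr m)] at h3

end MapData

end TypeYCycle

/-! ### Norm bounds and null sets in Euclidean space -/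

/-- The sharp factor √k is relaxed to K so that one constant serves the spaces of all sections. -/
theorem EuclideanSpace.norm_le_of_abs_le {k K : ℕ} (hk : k ≤ K) {a : ℝ} (ha : 0 ≤ a)
    {y : EuclideanSpace ℝ (Fin k)} (hy : ∀ l, |y l| ≤ a) : ‖y‖ ≤ K * a := by
  rw [EuclideanSpace.norm_eq]
  refine Real.sqrt_le_iff.2 ⟨by positivity, ?_⟩
  have h1 : ∑ l, ‖y l‖ ^ 2 ≤ k * a ^ 2 := by
    have := Finset.sum_le_card_nsmul Finset.univ (fun l => ‖y l‖ ^ 2) (a ^ 2)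
      fun l _ => pow_le_pow_left₀ (norm_nonneg _) (hy l) 2
    simpa using this
  have h2 : (k : ℝ) ≤ (K : ℝ) ^ 2 := by
    exact_mod_cast hk.trans (Nat.le_self_pow two_ne_zero K)
  calc ∑ l, ‖y l‖ ^ 2 ≤ k * a ^ 2 := h1
    _ ≤ (K : ℝ) ^ 2 * a ^ 2 := mul_le_mul_of_nonneg_right h2 (sq_nonneg a)
    _ = (K * a) ^ 2 := (mul_pow _ _ _).symm

theorem EuclideanSpace.abs_apply_le_norm {k : ℕ} (y : EuclideanSpace ℝ (Fin k)) (l : Fin k) :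
    |y l| ≤ ‖y‖ :=
  PiLp.norm_apply_le y l

theorem EuclideanSpace.volume_setOf_apply_eq_zero {k : ℕ} (l : Fin k) :
    volume {y : EuclideanSpace ℝ (Fin k) | y l = 0} = 0 := by
  let H : Submodule ℝ (EuclideanSpace ℝ (Fin k)) :=
    LinearMap.ker (EuclideanSpace.proj l : EuclideanSpace ℝ (Fin k) →L[ℝ] ℝ).toLinearMap
  have hH : H ≠ ⊤ := by
    intro h
    have h1 : EuclideanSpace.single l (1 : ℝ) ∈ H := h ▸ Submodule.mem_top
    have h2 : (EuclideanSpace.single l (1 : ℝ)) l = 0 := h1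
    simp at h2
  exact Measure.addHaar_submodule volume H hH

/-! ### The maps of the collection as monomials -/

namespace TypeYCycle

variable {n m : ℕ} [NeZero m] {f : EuclideanSpace ℝ (Fin n) → EuclideanSpace ℝ (Fin n)}

namespace MapData

variable {X : TypeYCycle f m} (D : X.MapData)

/-- The constant factors of the monomials that the map `g j` consists of. -/
def coefficient (j : Fin m) : Fin (X.nc j) ⊕ Fin (X.nt j) → ℝ
  | .inl d => D.β j (.inl d) * D.v₀ j d
  | .inr s => D.β j (.inr s)

theorem coefficient_ne_zero (j : Fin m) (i : Fin (X.nc j) ⊕ Fin (X.nt j)) :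
    D.coefficient j i ≠ 0 := by
  cases i with
  | inl d => exact mul_ne_zero (D.β_ne_zero _ _) (D.v₀_ne_zero _ _)
  | inr s => exact D.β_ne_zero _ _

theorem g_inl (j : Fin m) (x : EuclideanSpace ℝ (Fin (X.nt j + 1))) (d : Fin (X.nc j)) :
    D.g j x (D.perm j (.inl d)) =
      D.coefficient j (.inl d) * |x 0| ^ (-X.c j d / X.e j) := by
  simp only [g, Equiv.symm_apply_apply, localMap, coefficient]
  ring

theorem g_inr (j : Fin m) (x : EuclideanSpace ℝ (Fin (X.nt j + 1))) (s : Fin (X.nt j)) :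
    D.g j x (D.perm j (.inr s)) =
      D.coefficient j (.inr s) * (x s.succ * |x 0| ^ (-X.t j s / X.e j)) := by
  simp only [g, Equiv.symm_apply_apply, localMap, coefficient]

theorem sum_basicTransition_inl (j : Fin m) (d : Fin (X.nc j)) (F : Fin (X.nt j + 1) → ℝ) :
    ∑ l, D.basicTransition j (D.perm j (.inl d)) l * F l = -X.c j d / X.e j * F 0 := by
  rw [Fin.sum_univ_succ, Finset.sum_eq_zero, add_zero]
  · rw [basicTransition, Matrix.submatrix_apply, Equiv.symm_apply_apply]
    rfl
  · intro s _
    rw [basicTransition_inl_succ, zero_mul]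

theorem sum_basicTransition_inr (j : Fin m) (s : Fin (X.nt j)) (F : Fin (X.nt j + 1) → ℝ) :
    ∑ l, D.basicTransition j (D.perm j (.inr s)) l * F l =
      -X.t j s / X.e j * F 0 + F s.succ := by
  rw [Fin.sum_univ_succ]
  congr 1
  · rw [basicTransition, Matrix.submatrix_apply, Equiv.symm_apply_apply]
    rfl
  · rw [Finset.sum_eq_single s]
    · rw [basicTransition_inr_succ, if_pos rfl, one_mul]
    · intro s' _ h
      rw [basicTransition_inr_succ, if_neg h, zero_mul]
    · simp

theorem cyclicTransition_mulVec (F : (Σ j, Fin (X.nt j + 1)) → ℝ) (j : Fin m)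
    (k : Fin (X.nt (j + 1) + 1)) :
    D.cyclicTransition.mulVec F ⟨j + 1, k⟩ = ∑ l, D.basicTransition j k l * F ⟨j, l⟩ :=
  cyclicMatrix_mulVec (N := fun j => X.nt j + 1) D.basicTransition F j k

theorem cyclicTransition_vecMul (F : (Σ j, Fin (X.nt j + 1)) → ℝ) (j : Fin m)
    (l : Fin (X.nt j + 1)) :
    D.cyclicTransition.vecMul F ⟨j, l⟩ = ∑ k, F ⟨j + 1, k⟩ * D.basicTransition j k l :=
  cyclicMatrix_vecMul (N := fun j => X.nt j + 1) D.basicTransition F j l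

/-- All exponents are nonnegative, so the monomials are monotone in the |x_l|. The estimate is made
without logarithms and so includes points with vanishing coordinates. -/
theorem abs_g_le (hc : ∀ j d, X.c j d < 0) (he : ∀ j, 0 < X.e j) (ht : ∀ j s, X.t j s < 0)
    {U : (Σ j, Fin (X.nt j + 1)) → ℝ} {R : ℝ} {j : Fin m}
    {x : EuclideanSpace ℝ (Fin (X.nt j + 1))} (hx : ∀ l, |x l| ≤ Real.exp (-(R * U ⟨j, l⟩)))
    (i : Fin (X.nc j) ⊕ Fin (X.nt j)) :
    |D.g j x (D.perm j i)| ≤ |D.coefficient j i| *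
      Real.exp (-(R * D.cyclicTransition.mulVec U ⟨j + 1, D.perm j i⟩)) := by
  have hpow : ∀ b : ℝ, 0 ≤ b → |x 0| ^ b ≤ Real.exp (-(R * U ⟨j, 0⟩) * b) := by
    intro b hb
    rw [Real.exp_mul]
    exact Real.rpow_le_rpow (abs_nonneg _) (hx 0) hb
  rw [cyclicTransition_mulVec]
  cases i with
  | inl d =>
    rw [g_inl, abs_mul, sum_basicTransition_inl]
    refine mul_le_mul_of_nonneg_left ?_ (abs_nonneg _)
    rw [abs_of_nonneg (Real.rpow_nonneg (abs_nonneg _) _)]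
    refine (hpow _ (div_pos (neg_pos.2 (hc j d)) (he j)).le).trans_eq ?_
    congr 1
    ring
  | inr s =>
    rw [g_inr, abs_mul, sum_basicTransition_inr, abs_mul]
    refine mul_le_mul_of_nonneg_left ?_ (abs_nonneg _)
    rw [abs_of_nonneg (Real.rpow_nonneg (abs_nonneg _) _)]
    refine (mul_le_mul (hx s.succ) (hpow _ (div_pos (neg_pos.2 (ht j s)) (he j)).le)
      (Real.rpow_nonneg (abs_nonneg _) _) (Real.exp_pos _).le).trans_eq ?_
    rw [← Real.exp_add]
    congr 1
    ring

theorem g_ne_zero {j : Fin m} {x : EuclideanSpace ℝ (Fin (X.nt j + 1))} (hx : ∀ l, x l ≠ 0)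
    (k : Fin (X.nt (j + 1) + 1)) : D.g j x k ≠ 0 := by
  obtain ⟨i, rfl⟩ := (D.perm j).surjective k
  have h0 : 0 < |x 0| := abs_pos.2 (hx 0)
  cases i with
  | inl d =>
    rw [g_inl]
    exact mul_ne_zero (D.coefficient_ne_zero _ _) (Real.rpow_pos_of_pos h0 _).ne'
  | inr s =>
    rw [g_inr]
    exact mul_ne_zero (D.coefficient_ne_zero _ _)
      (mul_ne_zero (hx _) (Real.rpow_pos_of_pos h0 _).ne')

/-- In logarithmic coordinates the maps are affine, with the linear part `basicTransition`. -/
theorem log_g {j : Fin m} {x : EuclideanSpace ℝ (Fin (X.nt j + 1))} (hx : ∀ l, x l ≠ 0)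
    (k : Fin (X.nt (j + 1) + 1)) :
    Real.log (D.g j x k) = Real.log (D.coefficient j ((D.perm j).symm k)) +
      ∑ l, D.basicTransition j k l * Real.log (x l) := by
  obtain ⟨i, rfl⟩ := (D.perm j).surjective k
  rw [Equiv.symm_apply_apply]
  have h0 : 0 < |x 0| := abs_pos.2 (hx 0)
  cases i with
  | inl d =>
    rw [g_inl, sum_basicTransition_inl,
      Real.log_mul (D.coefficient_ne_zero _ _) (Real.rpow_pos_of_pos h0 _).ne',
      Real.log_rpow h0, Real.log_abs]
  | inr s =>
    rw [g_inr, sum_basicTransition_inr, Real.log_mul (D.coefficient_ne_zero _ _)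
      (mul_ne_zero (hx _) (Real.rpow_pos_of_pos h0 _).ne'),
      Real.log_mul (hx _) (Real.rpow_pos_of_pos h0 _).ne', Real.log_rpow h0, Real.log_abs]
    ring

theorem g_zero (hc : ∀ j d, X.c j d < 0) (he : ∀ j, 0 < X.e j) (j : Fin m) : D.g j 0 = 0 := by
  ext k
  obtain ⟨i, rfl⟩ := (D.perm j).surjective k
  cases i with
  | inl d =>
    rw [g_inl]
    simp [Real.zero_rpow (div_pos (neg_pos.2 (hc j d)) (he j)).ne']
  | inr s =>
    rw [g_inr]
    simp

theorem superpose_g_zero (hc : ∀ j d, X.c j d < 0) (he : ∀ j, 0 < X.e j) (i : ℕ) :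
    ∀ l : Fin m, superpose (N := fun j => X.nt j + 1) D.g i l 0 = 0 := by
  induction i with
  | zero => intro l; rfl
  | succ i ih =>
    intro l
    rw [superpose, D.g_zero hc he]
    exact ih (l + 1)

theorem isFixedPointOfCollection_zero (hc : ∀ j d, X.c j d < 0) (he : ∀ j, 0 < X.e j) :
    IsFixedPointOfCollection (N := fun j => X.nt j + 1) D.g 0 := by
  rw [IsFixedPointOfCollection, D.superpose_g_zero hc he]
  exact congrArg (fun j => (⟨j, 0⟩ : Σ j, EuclideanSpace ℝ (Fin (X.nt j + 1))))
    (iterate_succ_cycle m 0)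

/-! ### Stability -/

theorem superpose_g_abs_le {U : (Σ j, Fin (X.nt j + 1)) → ℝ} {q R₀ : ℝ} (hq : 1 ≤ q)
    (hR₀ : 0 ≤ R₀)
    (hstep : ∀ R ≥ R₀, ∀ (j : Fin m) (x : EuclideanSpace ℝ (Fin (X.nt j + 1))),
      (∀ l, |x l| ≤ Real.exp (-(R * U ⟨j, l⟩))) →
        ∀ k, |D.g j x k| ≤ Real.exp (-(q * R * U ⟨j + 1, k⟩))) (i : ℕ) :
    ∀ R ≥ R₀, ∀ (j : Fin m) (x : EuclideanSpace ℝ (Fin (X.nt j + 1))),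
      (∀ l, |x l| ≤ Real.exp (-(R * U ⟨j, l⟩))) →
        ∀ k : Fin (X.nt ((· + 1)^[i] j) + 1),
          |(superpose (N := fun j => X.nt j + 1) D.g i j x) k| ≤
            Real.exp (-(q ^ i * R * U ⟨(· + 1)^[i] j, k⟩)) := by
  induction i with
  | zero =>
    intro R _ j x hx k
    rw [pow_zero, one_mul]
    exact hx k
  | succ i ih =>
    intro R hR j x hx k
    have h := ih (q * R) (hR.trans (le_mul_of_one_le_left (hR₀.trans hR) hq)) (j + 1) (D.g j x)
      (hstep R hR j x hx) k
    rwa [← mul_assoc, ← pow_succ] at h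

theorem exists_contraction (hc : ∀ j d, X.c j d < 0) (he : ∀ j, 0 < X.e j)
    (ht : ∀ j s, X.t j s < 0) {U : (Σ j, Fin (X.nt j + 1)) → ℝ} {q : ℝ} (hq : 1 < q)
    (hU : ∀ t, 0 < U t) (hqU : ∀ t, q * U t ≤ D.cyclicTransition.mulVec U t) :
    ∃ q' > 1, ∃ R₀ ≥ 0, ∀ R ≥ R₀, ∀ (j : Fin m) (x : EuclideanSpace ℝ (Fin (X.nt j + 1))),
      (∀ l, |x l| ≤ Real.exp (-(R * U ⟨j, l⟩))) →
        ∀ k, |D.g j x k| ≤ Real.exp (-(q' * R * U ⟨j + 1, k⟩)) := by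
  obtain ⟨C, hC⟩ := (Set.finite_range fun t : Σ j, Fin (X.nc j) ⊕ Fin (X.nt j) =>
    |D.coefficient t.1 t.2|).bddAbove
  have : Nonempty (Σ j, Fin (X.nt j + 1)) := ⟨⟨0, 0⟩⟩
  obtain ⟨t₀, ht₀⟩ := Finite.exists_min U
  have hden : 0 < (q - 1) / 2 * U t₀ := mul_pos (by linarith) (hU t₀)
  -- Half of the surplus q - 1 pays for the coefficients: the threshold makes R (q - 1)/2 · min U at
  -- least the logarithm of their bound, and (1 + q)/2 remains.
  refine ⟨(1 + q) / 2, by linarith, max 0 (Real.log (max C 1) / ((q - 1) / 2 * U t₀)),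
    le_max_left _ _, fun R hR j x hx k => ?_⟩
  obtain ⟨i, rfl⟩ := (D.perm j).surjective k
  set t : Σ j, Fin (X.nt j + 1) := ⟨j + 1, D.perm j i⟩ with htdef
  have hR0 : 0 ≤ R := (le_max_left _ _).trans hR
  have hlog : Real.log (max C 1) ≤ R * ((q - 1) / 2 * U t₀) :=
    (div_le_iff₀ hden).1 ((le_max_right _ _).trans hR)
  have hCpos : 0 < max C 1 := lt_of_lt_of_le one_pos (le_max_right _ _)
  have hcoef : |D.coefficient j i| ≤ Real.exp (R * ((q - 1) / 2 * U t₀)) := by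
    refine le_trans ?_ ((Real.log_le_iff_le_exp hCpos).1 hlog)
    exact (hC ⟨⟨j, i⟩, rfl⟩).trans (le_max_left _ _)
  refine (D.abs_g_le hc he ht hx i).trans ?_
  refine (mul_le_mul_of_nonneg_right hcoef (Real.exp_pos _).le).trans ?_
  rw [← Real.exp_add, ← htdef]
  refine Real.exp_le_exp.2 ?_
  have h1 : R * (q * U t) ≤ R * D.cyclicTransition.mulVec U t :=
    mul_le_mul_of_nonneg_left (hqU t) hR0
  have h2 : R * ((q - 1) / 2 * U t₀) ≤ R * ((q - 1) / 2 * U t) :=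
    mul_le_mul_of_nonneg_left (mul_le_mul_of_nonneg_left (ht₀ t) (by linarith)) hR0
  linarith

theorem isAsymptoticallyStable_zero (hc : ∀ j d, X.c j d < 0) (he : ∀ j, 0 < X.e j)
    (ht : ∀ j s, X.t j s < 0) {U : (Σ j, Fin (X.nt j + 1)) → ℝ} {q : ℝ} (hq : 1 < q)
    (hU : ∀ t, 0 < U t) (hqU : ∀ t, q * U t ≤ D.cyclicTransition.mulVec U t) :
    IsAsymptoticallyStable (N := fun j => X.nt j + 1) D.g 0 := by
  refine ⟨D.isFixedPointOfCollection_zero hc he, fun δ hδ => ?_⟩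
  obtain ⟨q', hq', R₀, hR₀, hstep⟩ := D.exists_contraction hc he ht hq hU hqU
  have hiter := D.superpose_g_abs_le hq'.le hR₀ hstep
  have : Nonempty (Σ j, Fin (X.nt j + 1)) := ⟨⟨0, 0⟩⟩
  obtain ⟨t₀, ht₀⟩ := Finite.exists_min U
  obtain ⟨t₁, ht₁⟩ := Finite.exists_max U
  obtain ⟨K, hK⟩ := (Set.finite_range fun j => X.nt j + 1).bddAbove
  have hlim : Tendsto (fun R : ℝ => K * Real.exp (-(R * U t₀))) atTop (𝓝 0) := by
    have h := (Real.tendsto_exp_neg_atTop_nhds_zero.comp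
      (tendsto_id.atTop_mul_const (hU t₀))).const_mul (K : ℝ)
    rwa [mul_zero] at h
  obtain ⟨R, hRδ, hR⟩ := ((hlim.eventually (gt_mem_nhds hδ)).and
    (eventually_ge_atTop (max 1 R₀))).exists
  have hR1 : 0 < R := lt_of_lt_of_le one_pos ((le_max_left _ _).trans hR)
  have hbound : ∀ (l : Fin m) (x : EuclideanSpace ℝ (Fin (X.nt l + 1))),
      ‖x‖ < Real.exp (-(R * U t₁)) → ∀ i, ‖superpose (N := fun j => X.nt j + 1) D.g i l x‖ ≤
        K * Real.exp (-(q' ^ i * R * U t₀)) := by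
    intro l x hx i
    refine EuclideanSpace.norm_le_of_abs_le (hK ⟨_, rfl⟩) (Real.exp_pos _).le fun k => ?_
    refine (hiter i R ((le_max_right _ _).trans hR) l x (fun k => ?_) k).trans ?_
    · refine (EuclideanSpace.abs_apply_le_norm x k).trans (hx.le.trans (Real.exp_le_exp.2 ?_))
      exact neg_le_neg (mul_le_mul_of_nonneg_left (ht₁ _) hR1.le)
    · exact Real.exp_le_exp.2 (neg_le_neg (mul_le_mul_of_nonneg_left (ht₀ _) (by positivity)))
  -- `U t₁` is the maximum of `U`, so this ball lies in the box of parameter R in every section.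
  refine ⟨Real.exp (-(R * U t₁)), Real.exp_pos _, fun l _ x hx => ?_⟩
  rw [D.superpose_g_zero hc he, dist_zero_right] at hx
  have hb := hbound _ x hx
  rw [D.superpose_g_zero hc he]
  refine ⟨fun r _ k => ?_, fun r _ => ?_⟩
  · rw [D.superpose_g_zero hc he, dist_zero_right]
    refine (hb _).trans_lt (lt_of_le_of_lt ?_ hRδ)
    refine mul_le_mul_of_nonneg_left (Real.exp_le_exp.2 (neg_le_neg ?_)) (Nat.cast_nonneg K)
    exact mul_le_mul_of_nonneg_right
      (le_mul_of_one_le_left hR1.le (one_le_pow₀ hq'.le)) (hU t₀).le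
  · simp only [D.superpose_g_zero hc he, dist_zero_right]
    refine squeeze_zero (fun k => norm_nonneg _) (fun k => hb _) ?_
    have h1 : Tendsto (fun k : ℕ => r + k * m) atTop atTop :=
      tendsto_atTop_mono (fun k => (Nat.le_mul_of_pos_right k (Nat.pos_of_neZero m)).trans
        (Nat.le_add_left _ r)) tendsto_id
    exact hlim.comp (((tendsto_pow_atTop_atTop_of_one_lt hq').comp h1).atTop_mul_const hR1)

/-! ### Instability -/

/-- Pairing with the left eigenvector reduces the affine dynamics to a scalar recursion. `Real.log`
depends only on the absolute value, so signs of coordinates do not matter. -/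
theorem sum_log_g {p : (Σ j, Fin (X.nt j + 1)) → ℝ} {r : ℝ}
    (hrp : D.cyclicTransition.vecMul p = r • p) {j : Fin m}
    {x : EuclideanSpace ℝ (Fin (X.nt j + 1))} (hx : ∀ l, x l ≠ 0) :
    ∑ k, p ⟨j + 1, k⟩ * Real.log (D.g j x k) =
      (∑ k, p ⟨j + 1, k⟩ * Real.log (D.coefficient j ((D.perm j).symm k))) +
        r * ∑ l, p ⟨j, l⟩ * Real.log (x l) := by
  simp only [D.log_g hx, mul_add, Finset.sum_add_distrib, Finset.mul_sum]
  rw [Finset.sum_comm]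
  congr 1
  refine Finset.sum_congr rfl fun l _ => ?_
  have h := congrFun hrp ⟨j, l⟩
  rw [cyclicTransition_vecMul, Pi.smul_apply, smul_eq_mul] at h
  rw [← mul_assoc, ← h, Finset.sum_mul]
  exact Finset.sum_congr rfl fun k _ => (mul_assoc _ _ _).symm

/-- The condition on B says that each scalar map L ↦ const + rL sends [-B, ∞) into itself. -/
theorem neg_le_sum_log_superpose {p : (Σ j, Fin (X.nt j + 1)) → ℝ} {r B : ℝ} (hr : 0 ≤ r)
    (hrp : D.cyclicTransition.vecMul p = r • p)
    (hB : ∀ j, r * B - B ≤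
      ∑ k, p ⟨j + 1, k⟩ * Real.log (D.coefficient j ((D.perm j).symm k))) (i : ℕ) :
    ∀ (j : Fin m) (x : EuclideanSpace ℝ (Fin (X.nt j + 1))), (∀ l, x l ≠ 0) →
      -B ≤ ∑ l, p ⟨j, l⟩ * Real.log (x l) →
      -B ≤ ∑ k : Fin (X.nt ((· + 1)^[i] j) + 1), p ⟨(· + 1)^[i] j, k⟩ *
        Real.log ((superpose (N := fun j => X.nt j + 1) D.g i j x) k) := by
  induction i with
  | zero => exact fun j x _ h => h
  | succ i ih =>
    intro j x hx h
    refine ih (j + 1) (D.g j x) (D.g_ne_zero hx) ?_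
    rw [D.sum_log_g hrp hx]
    have h1 := mul_le_mul_of_nonneg_left h hr
    have h2 := hB j
    linarith

theorem isCompletelyUnstable_zero (hc : ∀ j d, X.c j d < 0) (he : ∀ j, 0 < X.e j)
    {p : (Σ j, Fin (X.nt j + 1)) → ℝ} {r : ℝ} (hr : 0 ≤ r) (hr1 : r < 1)
    (hp : ∀ t, 0 ≤ p t) (hp0 : ∀ j, 0 < p ⟨j, 0⟩)
    (hrp : D.cyclicTransition.vecMul p = r • p) :
    IsCompletelyUnstable (N := fun j => X.nt j + 1) D.g 0 := by
  -- Any radius would do, since only convergence is contradicted.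
  refine ⟨D.isFixedPointOfCollection_zero hc he, 1, one_pos, ?_⟩
  refine measure_mono_null (t := ⋃ l, {x | x l = 0}) ?_
    (measure_iUnion_null fun l => EuclideanSpace.volume_setOf_apply_eq_zero l)
  rintro x ⟨-, hx⟩
  by_contra hne
  replace hne : ∀ l, x l ≠ 0 := fun l hl => hne (Set.mem_iUnion.2 ⟨l, hl⟩)
  obtain ⟨b, hb⟩ := (Set.finite_range fun j =>
    ∑ k, p ⟨j + 1, k⟩ * Real.log (D.coefficient j ((D.perm j).symm k))).bddBelow
  obtain ⟨j₀, hj₀⟩ := Finite.exists_min fun j : Fin m => p ⟨j, 0⟩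
  -- The first term makes -B a barrier for the recursion (here r < 1 is needed), the second puts the
  -- starting value above it.
  set B := max (-b / (1 - r)) (-∑ l, p ⟨0, l⟩ * Real.log (x l)) with hBdef
  have hB : r * B - B ≤ b := by
    have h := (div_le_iff₀ (by linarith)).1 (le_max_left (-b / (1 - r)) _ : _ ≤ B)
    linarith
  have hlow := fun i => D.neg_le_sum_log_superpose hr hrp (fun j => hB.trans (hb ⟨j, rfl⟩)) i 0 x hne
    (neg_le.1 (le_max_right _ _))
  have hlim := hx 0 (Nat.pos_of_neZero m)
  simp only [D.superpose_g_zero hc he, dist_zero_right] at hlim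
  -- Below 1 all logarithms are nonpositive; the second bound lets the expanding coordinate alone
  -- push the sum below -B. The minimal weight `p ⟨j₀, 0⟩` makes this uniform in the section, so the
  -- section after k rounds need not be identified with section 0.
  have hε : 0 < min 1 (Real.exp (-(|B| + 1) / p ⟨j₀, 0⟩)) := lt_min one_pos (Real.exp_pos _)
  obtain ⟨k, hk⟩ := (hlim.eventually (gt_mem_nhds hε)).exists
  have hup : ∀ (j : Fin m) (y : EuclideanSpace ℝ (Fin (X.nt j + 1))),
      ‖y‖ < min 1 (Real.exp (-(|B| + 1) / p ⟨j₀, 0⟩)) → (∀ l, y l ≠ 0) →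
        ∑ l, p ⟨j, l⟩ * Real.log (y l) < -B := by
    intro j y hy hy0
    have hneg : ∀ l, Real.log (y l) ≤ 0 := fun l => by
      rw [← Real.log_abs]
      exact Real.log_nonpos (abs_nonneg _) ((EuclideanSpace.abs_apply_le_norm y l).trans
        (hy.le.trans (min_le_left _ _)))
    have h0 : Real.log (y 0) ≤ -(|B| + 1) / p ⟨j₀, 0⟩ := by
      rw [← Real.log_abs, Real.log_le_iff_le_exp (abs_pos.2 (hy0 0))]
      exact (EuclideanSpace.abs_apply_le_norm y 0).trans (hy.le.trans (min_le_right _ _))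
    rw [le_div_iff₀ (hp0 j₀)] at h0
    have h1 : ∑ l, p ⟨j, l⟩ * Real.log (y l) ≤ p ⟨j, 0⟩ * Real.log (y 0) := by
      rw [Fin.sum_univ_succ]
      have : ∑ s : Fin (X.nt j), p ⟨j, s.succ⟩ * Real.log (y s.succ) ≤ 0 :=
        Finset.sum_nonpos fun s _ => mul_nonpos_of_nonneg_of_nonpos (hp _) (hneg _)
      linarith
    have h2 : p ⟨j, 0⟩ * Real.log (y 0) ≤ p ⟨j₀, 0⟩ * Real.log (y 0) :=
      mul_le_mul_of_nonpos_right (hj₀ j) (hneg 0)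
    have h3 := le_abs_self B
    linarith
  have hnz : ∀ (i : ℕ) (j : Fin m) (y : EuclideanSpace ℝ (Fin (X.nt j + 1))), (∀ l, y l ≠ 0) →
      ∀ l : Fin (X.nt ((· + 1)^[i] j) + 1),
        (superpose (N := fun j => X.nt j + 1) D.g i j y) l ≠ 0 := by
    intro i
    induction i with
    | zero => exact fun j y h => h
    | succ i ih => exact fun j y h => ih (j + 1) (D.g j y) (D.g_ne_zero h)
  exact (hlow _).not_gt (hup _ _ hk (hnz _ 0 x hne))

end MapData

end TypeYCycle

/-! ### The stability theorem -/

theorem theorem3 {n m : ℕ} [NeZero m]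
    {f : EuclideanSpace ℝ (Fin n) → EuclideanSpace ℝ (Fin n)}
    (X : TypeYCycle f m)
    (hc : ∀ j d, X.c j d < 0) (he : ∀ j, 0 < X.e j) (ht : ∀ j s, X.t j s < 0)
    (D : X.MapData)
    (lam : ℂ) (hlam : D.IsLargestSignificantEigenvalue lam) :
    lam.im = 0 ∧
    (1 < lam.re → IsAsymptoticallyStable (N := fun j => X.nt j + 1) D.g 0) ∧
    (lam.re < 1 → IsCompletelyUnstable (N := fun j => X.nt j + 1) D.g 0) := by
  obtain ⟨r, hr, rfl, u, p, hu, hu0, hp, hp0, hru, hrp⟩ :=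
    D.exists_perron_eigenvectors hc he ht hlam
  refine ⟨Complex.ofReal_im _, fun h => ?_, fun h => ?_⟩
  · rw [Complex.ofReal_re] at h
    have hr1 : 1 < r := lt_of_not_ge fun h' => h.not_ge (pow_le_one₀ hr h')
    have : Nonempty (Σ j, Fin (X.nt j + 1)) := ⟨⟨0, 0⟩⟩
    obtain ⟨q, hq, U, hU, hqU⟩ := Matrix.exists_pos_growing (D.cyclicTransition_nonneg hc he ht)
      -- Every row has a positive entry in the column of the preceding section's expanding
      -- coordinate, which is significant.
      hr1 hu hu0 hru (fun t _ => by
        obtain ⟨j, k, rfl⟩ := exists_eq_mk_succ (N := fun j => X.nt j + 1) t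
        refine ⟨⟨j, 0⟩, D.significant_zero j, ?_⟩
        rw [D.cyclicTransition_apply]
        exact D.basicTransition_zero_pos hc he ht j k)
    exact D.isAsymptoticallyStable_zero hc he ht hq hU hqU
  · rw [Complex.ofReal_re] at h
    have hr1 : r < 1 := lt_of_not_ge fun h' => h.not_ge (one_le_pow₀ h')
    refine D.isCompletelyUnstable_zero hc he hr hr1 (fun t => ?_)
      (fun j => hp _ (D.significant_zero j)) hrp
    by_cases ht' : D.Significant t
    · exact (hp t ht').le
    · exact (hp0 t ht').ge
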